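/- Let $(\Omega,\mathcal F,\mathsf P)$ be a probability space. For a probability measure $\mathsf Q$ and a random variable $X$ put $\mathsf E_{\mathsf Q}X=\mathsf E_{\mathsf Q}X^+-\mathsf E_{\mathsf Q}X^-\in[-\infty,\infty]$ with the convention $\infty-\infty=-\infty$; all integrals of extended-real functions are understood in the same way. Let $\mathcal P$ be the set of probability measures on $\mathcal F$ that are absolutely continuous with respect to $\mathsf P$. For $\lambda\in(0,1]$ let $$u_\lambda(X)=\inf\bigl\{\mathsf E_{\mathsf Q}X:\ \mathsf Q\in\mathcal P,\ d\mathsf Q/d\mathsf P\le\lambda^{-1}\bigr\},$$ and for real $-1<\beta<\alpha$ let $$u_{\alpha,\beta}(X)=\int_{(0,1]}u_\lambda(X)\,\mu_{\alpha,\beta}(d\lambda),\qquad \mu_{\alpha,\beta}(dx)=\mathrm B(\beta+1,\alpha-\beta)^{-1}x^{\beta}(1-x)^{\alpha-\beta-1}\,dx\ \text{ on }[0,1];$$ these are the coherent utilities of Tail V@R and of Beta V@R. Put $u_\alpha=u_{\alpha,1}$ for $\alpha>1$ (Alpha V@R). For a coherent utility $u$, let $\mathcal D=\{\mathsf Q\in\mathcal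 P:\mathsf E_{\mathsf Q}Y\ge u(Y)\text{ for every random variable }Y\}$ be its determining set. The utility contribution of $X$ to $W$ is $$u^c(X;W)=\inf\bigl\{\mathsf E_{\mathsf Q}X:\ \mathsf Q\in\mathcal D,\ \mathsf E_{\mathsf Q}W=u(W)\in(-\infty,\infty)\bigr\}.$$ Write $u^c_{\alpha,\beta}$ and $u^c_\alpha$ for the utility contributions that correspond to $u_{\alpha,\beta}$ and $u_\alpha$. Let $\alpha\ge2$ be an integer, let $X,W\in L^1(\mathsf P)$, and suppose that $W$ has a continuous distribution (one without atoms). Let $(X_1,W_1),\dots,(X_\alpha,W_\alpha)$ be independent copies of $(X,W)$, defined on some probability space with expectation $\mathsf E$, and let $W_{(1)}\le\dots\le W_{(\alpha)}$ be the order statistics of $W_1,\dots,W_\alpha$. Then the following hold. (0) Almost surely, for every $i\in\{1,\dots,\alpha\}$ there is exactly one index $n(i)\in\{1,\dots,\alpha\}$ with $W_{n(i)}=W_{(i)}$. (1) Let $\beta$ be an integer with $1\le\beta<\alpha$, and let $\xi$ be uniformly distributed on $\{1,\dots,\beta\}$ and independent of $((X_i,W_i))_{i\le\alpha}$. Then $X_{n(\xi)}$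 is integrable and $$u^c_{\alpha,\beta}(X;W)=\mathsf E X_{n(\xi)}.$$ (2) The random variable $X_{\operatorname{argmin}_{i=1,\dots,\alpha}W_i}$ is integrable and $$u^c_\alpha(X;W)=\mathsf E X_{\operatorname{argmin}_{i=1,\dots,\alpha}W_i}.$$ -/

import Mathlib

open MeasureTheory ProbabilityTheory Set
open scoped ENNReal

noncomputable section

namespace RiskContribution

variable {Ω : Type*} [MeasurableSpace Ω]

/-- The extended integral `∫ f⁺ dQ - ∫ f⁻ dQ` with values in `[-∞, ∞]`. Subtraction in `EReal`
satisfies `⊤ - ⊤ = ⊥`, which is the convention `∞ - ∞ = -∞`. -/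
def extIntegral (Q : Measure Ω) (f : Ω → EReal) : EReal :=
  ((∫⁻ ω, (f ω).toENNReal ∂Q : ℝ≥0∞) : EReal) - ((∫⁻ ω, (-f ω).toENNReal ∂Q : ℝ≥0∞) : EReal)

/-- The expectation `E_Q X` of an arbitrary real random variable, in `[-∞, ∞]`. -/
def extExp (Q : Measure Ω) (X : Ω → ℝ) : EReal :=
  extIntegral Q fun ω => (X ω : EReal)

/-- The set of probability measures that are absolutely continuous with respect to `P`. -/
def absContProb (P : Measure Ω) : Set (Measure Ω) :=
  {Q | IsProbabilityMeasure Q ∧ Q ≪ P}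

/-- The functional `u(X) = inf_{Q ∈ D} E_Q X`. -/
def infExp (D : Set (Measure Ω)) (X : Ω → ℝ) : EReal :=
  ⨅ Q ∈ D, extExp Q X

/-- The set `{Q : Q ≪ P a probability measure, dQ/dP ≤ 1/l}` that defines Tail V@R of order `l`. -/
def tailSet (P : Measure Ω) (l : ℝ) : Set (Measure Ω) :=
  {Q | Q ∈ absContProb P ∧ ∀ᵐ ω ∂P, Q.rnDeriv P ω ≤ ENNReal.ofReal l⁻¹}

/-- The coherent utility `u_l` of Tail V@R of order `l`, for `0 < l ≤ 1`. -/
def tailUtility (P : Measure Ω) (l : ℝ) : (Ω → ℝ) → EReal :=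
  infExp (tailSet P l)

/-- The coherent utility `u_μ(X) = ∫_{(0,1]} u_l(X) μ(dl)` of Weighted V@R with the weighting
measure `μ`. -/
def weightedUtility (P : Measure Ω) (μ : Measure ℝ) (X : Ω → ℝ) : EReal :=
  extIntegral (μ.restrict (Ioc 0 1)) fun l => tailUtility P l X

/-- The coherent utility `u_{α,β}` of Beta V@R: the weighting measure has the density
`B(β + 1, α - β)⁻¹ x ^ β (1 - x) ^ (α - β - 1)` on `(0, 1)`. -/
def betaUtility (P : Measure Ω) (α β : ℝ) : (Ω → ℝ) → EReal :=
  weightedUtility P (betaMeasure (β + 1) (α - β))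

/-- The coherent utility `u_α` of Alpha V@R. -/
def alphaUtility (P : Measure Ω) (α : ℝ) : (Ω → ℝ) → EReal :=
  betaUtility P α 1

/-- The determining set of a coherent utility `u` on the space of all random variables: the
largest set `D` of probability measures absolutely continuous with respect to `P` for which
`u(X) = inf_{Q ∈ D} E_Q X`. -/
def determiningSet (P : Measure Ω) (u : (Ω → ℝ) → EReal) : Set (Measure Ω) :=
  {Q | Q ∈ absContProb P ∧ ∀ X : Ω → ℝ, Measurable X → u X ≤ extExp Q X}

/-- The set of extreme measures for `W`: the `Q` in the determining set of `u` with
`E_Q W = u(W) ∈ (-∞, ∞)`. -/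
def extremeMeasures (P : Measure Ω) (u : (Ω → ℝ) → EReal) (W : Ω → ℝ) : Set (Measure Ω) :=
  {Q | Q ∈ determiningSet P u ∧ extExp Q W = u W ∧ u W ≠ ⊥ ∧ u W ≠ ⊤}

/-- The utility contribution `u^c(X; W)`, the infimum of `E_Q X` over the extreme measures `Q`
for `W`. -/
def utilityContribution (P : Measure Ω) (u : (Ω → ℝ) → EReal) (X W : Ω → ℝ) : EReal :=
  infExp (extremeMeasures P u W) X

/-- The order statistics of `w`: `orderStat w i` is the entry with (zero-based) index `i` in the
increasing rearrangement of `w`. -/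
def orderStat {m : ℕ} (w : Fin m → ℝ) (i : Fin m) : ℝ :=
  w (Tuple.sort w i)

end RiskContribution

end

/-! Let `F` be the distribution function of `W`, so that `U = F(W)` is uniform. For Tail V@R of
order `l`, the measure with density `1/l` on `{U ≤ l}` minimizes the mean of every integrable
increasing function of `W`. Mixing these minimizers over the weighting measure `μ` gives, by
Tonelli, the spectral measure `S` with density `g(U)`, where `g(u) = ∫_{[u,1]} l⁻¹ μ(dl)`.

The core is that `S` is the only extreme measure for `W` (`extremeMeasures_weightedUtility`), so
that the contribution of `X` is `E[g(U) X]`. Let `Q` be extreme. For a `K`-Lipschitz `φ` both `K w +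
φ(w)` and `K w - φ(w)` increase. The optimality of `S` for increasing functions, with `E_Q W = E_S
W`, then forces `E_Q φ(W) = E_S φ(W)`, and `W` has the same law under `Q` and `S`. Testing `Q` on
the variables `-1_{{W ≤ c} ∪ B}` with `B ⊆ {W > c}` and cancelling the mass of `{W ≤ c}` gives `Q(B)
≤ g(F(c)) P(B)`. Letting `c` increase to `W` gives `Q ≤ S`, hence equality.

For Beta V@R with integer parameters, `l⁻¹` times the beta density is a constant times a Bernstein
polynomial. Integration gives `g(u) = (α/β) P(Bin(α-1, u) < β)` (`setLIntegral_inv_betaMeasure`).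
Given copy `j`, the number of other copies with a smaller `W` is binomial with parameters `α-1` and
`F(W_j)`. So `E[g(U) X]` is `1/β` times the expected sum of those `X_j` whose `W_j` is among the `β`
smallest, which is the mean of `X` at a uniformly chosen one of these ranks. -/

namespace RiskContribution

/-! ### Integrals with values in `[-∞, ∞]`. -/

section ExtendedIntegral

variable {Ω : Type*} [MeasurableSpace Ω] {Q : Measure Ω}

lemma extIntegral_mono_ae {f g : Ω → EReal} (h : ∀ᵐ ω ∂Q, f ω ≤ g ω) :
    extIntegral Q f ≤ extIntegral Q g := by
  refine EReal.sub_le_sub ?_ ?_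
  · exact EReal.coe_ennreal_le_coe_ennreal_iff.2
      (lintegral_mono_ae (h.mono fun ω hω => EReal.toENNReal_le_toENNReal hω))
  · exact EReal.coe_ennreal_le_coe_ennreal_iff.2
      (lintegral_mono_ae (h.mono fun ω hω =>
        EReal.toENNReal_le_toENNReal (EReal.neg_le_neg_iff.2 hω)))

lemma extIntegral_congr_ae {f g : Ω → EReal} (h : ∀ᵐ ω ∂Q, f ω = g ω) :
    extIntegral Q f = extIntegral Q g :=
  le_antisymm (extIntegral_mono_ae (h.mono fun _ hω => hω.le))
    (extIntegral_mono_ae (h.mono fun _ hω => hω.ge))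

/-- The positive and negative parts of `a - b` are the truncated differences, and `(a - b) + b = max
a b = (b - a) + a`. Integrating and subtracting is legitimate because all four integrals are finite.
-/
lemma extIntegral_coe_sub {a b : Ω → ℝ≥0∞} (ha : AEMeasurable a Q) (hb : AEMeasurable b Q)
    (ha' : ∫⁻ ω, a ω ∂Q ≠ ∞) (hb' : ∫⁻ ω, b ω ∂Q ≠ ∞) :
    extIntegral Q (fun ω => (a ω : EReal) - b ω) =
      ((∫⁻ ω, a ω ∂Q : ℝ≥0∞) : EReal) - ((∫⁻ ω, b ω ∂Q : ℝ≥0∞) : EReal) := by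
  have h1 : ∫⁻ ω, ((a ω : EReal) - b ω).toENNReal ∂Q = ∫⁻ ω, (a ω - b ω) ∂Q := by
    refine lintegral_congr fun ω => ?_
    rw [EReal.toENNReal_sub (EReal.coe_ennreal_nonneg _)]
    simp
  have h2 : ∫⁻ ω, (-((a ω : EReal) - b ω)).toENNReal ∂Q = ∫⁻ ω, (b ω - a ω) ∂Q := by
    refine lintegral_congr_ae ?_
    filter_upwards [ae_lt_top' ha ha'] with ω hω
    rw [EReal.neg_sub (Or.inl (by simp)) (Or.inl (by simpa using hω.ne)), add_comm,
      ← sub_eq_add_neg, EReal.toENNReal_sub (EReal.coe_ennreal_nonneg _)]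
    simp
  have h3 : ∫⁻ ω, (a ω - b ω) ∂Q + ∫⁻ ω, b ω ∂Q = ∫⁻ ω, (b ω - a ω) ∂Q + ∫⁻ ω, a ω ∂Q := by
    rw [← lintegral_add_right' _ hb, ← lintegral_add_right' _ ha]
    refine lintegral_congr fun ω => ?_
    rw [tsub_add_eq_max, tsub_add_eq_max, max_comm]
  have h4 : ∫⁻ ω, (a ω - b ω) ∂Q ≠ ∞ :=
    ne_top_of_le_ne_top ha' (lintegral_mono fun ω => tsub_le_self)
  have h5 : ∫⁻ ω, (b ω - a ω) ∂Q ≠ ∞ :=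
    ne_top_of_le_ne_top hb' (lintegral_mono fun ω => tsub_le_self)
  rw [extIntegral, h1, h2]
  generalize (∫⁻ ω, (a ω - b ω) ∂Q) = x at *
  generalize (∫⁻ ω, (b ω - a ω) ∂Q) = y at *
  generalize (∫⁻ ω, a ω ∂Q) = s at *
  generalize (∫⁻ ω, b ω ∂Q) = t at *
  lift x to NNReal using h4
  lift y to NNReal using h5
  lift s to NNReal using ha'
  lift t to NNReal using hb'
  have h6 : x + t = y + s := by exact_mod_cast h3
  have h7 : (x : ℝ) + t = y + s := by exact_mod_cast h6
  simp only [← EReal.coe_ennreal_toReal ENNReal.coe_ne_top, ENNReal.coe_toReal]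
  rw [← EReal.coe_sub, ← EReal.coe_sub]
  congr 1
  linarith

lemma extExp_eq (Q : Measure Ω) (X : Ω → ℝ) :
    extExp Q X = ((∫⁻ ω, ENNReal.ofReal (X ω) ∂Q : ℝ≥0∞) : EReal) -
      ((∫⁻ ω, ENNReal.ofReal (-X ω) ∂Q : ℝ≥0∞) : EReal) := by
  simp only [extExp, extIntegral, ← EReal.coe_neg, EReal.real_coe_toENNReal]

lemma extExp_of_integrable {X : Ω → ℝ} (hX : Integrable X Q) :
    extExp Q X = ((∫ ω, X ω ∂Q : ℝ) : EReal) := by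
  have h1 : ∫⁻ ω, ENNReal.ofReal (X ω) ∂Q ≠ ∞ := hX.lintegral_lt_top.ne
  have h2 : ∫⁻ ω, ENNReal.ofReal (-X ω) ∂Q ≠ ∞ := hX.neg.lintegral_lt_top.ne
  rw [extExp_eq, integral_eq_lintegral_pos_part_sub_lintegral_neg_part hX, EReal.coe_sub,
    EReal.coe_ennreal_toReal h1, EReal.coe_ennreal_toReal h2]

lemma extExp_congr_ae {X Y : Ω → ℝ} (h : X =ᵐ[Q] Y) : extExp Q X = extExp Q Y :=
  extIntegral_congr_ae (h.mono fun ω hω => by rw [hω])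

lemma integrable_of_extExp_ne {X : Ω → ℝ} (hX : AEStronglyMeasurable X Q)
    (h1 : extExp Q X ≠ ⊥) (h2 : extExp Q X ≠ ⊤) : Integrable X Q := by
  rw [extExp_eq] at h1 h2
  have hb : ∫⁻ ω, ENNReal.ofReal (-X ω) ∂Q ≠ ∞ := by
    intro hb
    exact h1 (by rw [hb, EReal.coe_ennreal_top, EReal.sub_top])
  have ha : ∫⁻ ω, ENNReal.ofReal (X ω) ∂Q ≠ ∞ := by
    intro ha
    exact h2 (by rw [ha, EReal.coe_ennreal_top, EReal.top_sub (by simpa using hb)])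
  refine ⟨hX, ?_⟩
  rw [hasFiniteIntegral_iff_norm]
  calc ∫⁻ ω, ENNReal.ofReal ‖X ω‖ ∂Q
      ≤ ∫⁻ ω, (ENNReal.ofReal (X ω) + ENNReal.ofReal (-X ω)) ∂Q := by
        refine lintegral_mono fun ω => ?_
        rcases le_total 0 (X ω) with h | h
        · simp [Real.norm_eq_abs, abs_of_nonneg h]
        · simp [Real.norm_eq_abs, abs_of_nonpos h]
    _ = ∫⁻ ω, ENNReal.ofReal (X ω) ∂Q + ∫⁻ ω, ENNReal.ofReal (-X ω) ∂Q :=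
        lintegral_add_left' hX.aemeasurable.ennreal_ofReal _
    _ < ∞ := ENNReal.add_lt_top.2 ⟨ha.lt_top, hb.lt_top⟩

end ExtendedIntegral

/-! ### Measures with density bounded by `1/l`. -/

section Tail

variable {Ω : Type*} [MeasurableSpace Ω] {P : Measure Ω}

lemma mem_tailSet_iff [IsProbabilityMeasure P] {Q : Measure Ω} {l : ℝ} :
    Q ∈ tailSet P l ↔ IsProbabilityMeasure Q ∧ Q ≤ ENNReal.ofReal l⁻¹ • P := by
  constructor
  · rintro ⟨⟨h1, h2⟩, h3⟩
    refine ⟨h1, ?_⟩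
    rw [← Measure.withDensity_rnDeriv_eq Q P h2, ← withDensity_const]
    exact withDensity_mono h3
  · rintro ⟨h1, h2⟩
    have hac : Q ≪ P := (Measure.absolutelyContinuous_of_le h2).trans
      Measure.smul_absolutelyContinuous
    refine ⟨⟨h1, hac⟩, ?_⟩
    refine ae_le_of_forall_setLIntegral_le_of_sigmaFinite (Measure.measurable_rnDeriv Q P)
      fun s hs _ => ?_
    rw [Measure.setLIntegral_rnDeriv hac, setLIntegral_const]
    simpa using h2 s

/-- Neyman–Pearson argument: `t - Y` is nonnegative on `S`, where `Q` is dominated by `c • P`, and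
nonpositive off `S`. Both measures have mass one, so `t` cancels. -/
lemma integral_smul_restrict_le_of_threshold {Q : Measure Ω} [IsProbabilityMeasure Q] {c : ℝ≥0∞}
    {S : Set Ω} (hS : MeasurableSet S) (hc : c ≠ ∞) [IsProbabilityMeasure (c • P.restrict S)]
    (hQ : Q ≤ c • P) {Y : Ω → ℝ} (hY : Integrable Y P) {t : ℝ} (h1 : ∀ ω ∈ S, Y ω ≤ t)
    (h2 : ∀ ω ∉ S, t ≤ Y ω) :
    ∫ ω, Y ω ∂(c • P.restrict S) ≤ ∫ ω, Y ω ∂Q := by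
  have hYc : Integrable Y (c • P) := hY.smul_measure hc
  have hYQ : Integrable Y Q := hYc.mono_measure hQ
  have hYR : Integrable Y (c • P.restrict S) := hY.restrict.smul_measure hc
  have e1 : ∫ ω, (t - Y ω) ∂Q = t - ∫ ω, Y ω ∂Q := by
    rw [integral_sub (integrable_const _) hYQ]; simp
  have e2 : ∫ ω, (t - Y ω) ∂(c • P.restrict S) = t - ∫ ω, Y ω ∂(c • P.restrict S) := by
    rw [integral_sub (integrable_const _) hYR]; simp
  have e3 : ∫ ω in S, (t - Y ω) ∂Q ≤ ∫ ω, (t - Y ω) ∂(c • P.restrict S) := by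
    refine integral_mono_measure ?_ ?_ ((integrable_const _).sub hYR)
    · rw [← Measure.restrict_smul]
      exact Measure.restrict_mono le_rfl hQ
    · rw [← Measure.restrict_smul]
      filter_upwards [ae_restrict_mem hS] with ω hω
      simpa using h1 ω hω
  have e4 : ∫ ω in Sᶜ, (t - Y ω) ∂Q ≤ 0 :=
    setIntegral_nonpos hS.compl fun ω hω => by simpa using h2 ω hω
  have e5 := integral_add_compl hS ((integrable_const t).sub hYQ)
  simp only [Pi.sub_apply] at e5
  linarith

end Tail

/-! ### Atomless laws on the line and their distribution functions. -/

section Cdf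

variable {ρ : Measure ℝ} [IsProbabilityMeasure ρ]

lemma continuous_cdf (hρ : ∀ c, ρ {c} = 0) : Continuous (cdf ρ) := by
  rw [continuous_iff_continuousAt]
  intro c
  rw [(monotone_cdf ρ).continuousAt_iff_leftLim_eq_rightLim, StieltjesFunction.rightLim_eq]
  refine le_antisymm ((monotone_cdf ρ).leftLim_le le_rfl) ?_
  have h := (cdf ρ).measure_singleton c
  rw [measure_cdf, hρ, eq_comm, ENNReal.ofReal_eq_zero] at h
  linarith

lemma exists_cdf_eq (hρ : ∀ c, ρ {c} = 0) {l : ℝ} (hl : l ∈ Ioo (0 : ℝ) 1) :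
    ∃ q, cdf ρ q = l := by
  have h0 := ((tendsto_cdf_atBot ρ).eventually (gt_mem_nhds hl.1)).exists
  have h1 := ((tendsto_cdf_atTop ρ).eventually (lt_mem_nhds hl.2)).exists
  obtain ⟨a, ha⟩ := h0
  obtain ⟨b, hb⟩ := h1
  exact mem_range_of_exists_le_of_exists_ge (continuous_cdf hρ) ⟨a, ha.le⟩ ⟨b, hb.le⟩

/-- The probability integral transform. -/
lemma measure_cdf_le (hρ : ∀ c, ρ {c} = 0) {l : ℝ} (hl : l ∈ Ioo (0 : ℝ) 1) :
    ρ {w | cdf ρ w ≤ l} = ENNReal.ofReal l := by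
  refine le_antisymm ?_ ?_
  -- `F` may be flat at level `l`, so points with `F w ≤ l` need not lie below a chosen quantile of
  -- `l`. They do lie below any quantile of a larger `l'`, which then decreases to `l`.
  · have key : ∀ l' ∈ Ioo l 1, ρ {w | cdf ρ w ≤ l} ≤ ENNReal.ofReal l' := by
      intro l' hl'
      obtain ⟨q, hq⟩ := exists_cdf_eq hρ ⟨hl.1.trans hl'.1, hl'.2⟩
      rw [← hq, ofReal_cdf]
      refine measure_mono fun w hw => ?_
      by_contra h
      have := monotone_cdf ρ (not_le.1 h).le
      have hw' : cdf ρ w ≤ l := hw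
      linarith [hl'.1]
    have ht : Filter.Tendsto (fun x => ENNReal.ofReal x) (nhdsWithin l (Ioi l))
        (nhds (ENNReal.ofReal l)) :=
      (ENNReal.continuous_ofReal.tendsto l).mono_left nhdsWithin_le_nhds
    refine ge_of_tendsto ht ?_
    filter_upwards [Ioo_mem_nhdsGT hl.2] with x hx using key x hx
  · obtain ⟨q, hq⟩ := exists_cdf_eq hρ hl
    rw [← hq, ofReal_cdf]
    exact measure_mono fun w hw => monotone_cdf ρ hw

end Cdf

/-! ### Tail minimizers for an atomless `W`. -/

variable {Ω : Type*} [MeasurableSpace Ω]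

/-- The uniformly distributed variable `F(W)`, with `F` the distribution function of `W`. -/
noncomputable def cdfTransform (P : Measure Ω) (W : Ω → ℝ) (ω : Ω) : ℝ :=
  cdf (P.map W) (W ω)

/-- The minimizer of `E_Q W` in the determining set of Tail V@R of order `l`. -/
noncomputable def tailMeasure (P : Measure Ω) (W : Ω → ℝ) (l : ℝ) : Measure Ω :=
  ENNReal.ofReal l⁻¹ • P.restrict {ω | cdfTransform P W ω ≤ l}

/-- The measure with density `g (F(W))`. -/
noncomputable def spectralMeasure (P : Measure Ω) (W : Ω → ℝ) (g : ℝ → ℝ) : Measure Ω :=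
  P.withDensity fun ω => ENNReal.ofReal (g (cdfTransform P W ω))

lemma cdfTransform_mem (P : Measure Ω) (W : Ω → ℝ) (ω : Ω) :
    cdfTransform P W ω ∈ Icc (0 : ℝ) 1 :=
  ⟨cdf_nonneg _ _, cdf_le_one _ _⟩

lemma measurable_cdfTransform (P : Measure Ω) {W : Ω → ℝ} (hW : Measurable W) :
    Measurable (cdfTransform P W) :=
  (monotone_cdf (P.map W)).measurable.comp hW

lemma measurableSet_cdfTransform_le (P : Measure Ω) {W : Ω → ℝ} (hW : Measurable W) (l : ℝ) :
    MeasurableSet {ω | cdfTransform P W ω ≤ l} :=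
  measurableSet_le (measurable_cdfTransform P hW) measurable_const

lemma lt_of_cdfTransform_lt {P : Measure Ω} {W : Ω → ℝ} {ω : Ω} {c : ℝ}
    (h : cdfTransform P W ω < cdf (P.map W) c) : W ω < c :=
  (monotone_cdf (P.map W)).reflect_lt h

lemma map_singleton_eq_zero {P : Measure Ω} {W : Ω → ℝ} (hW : Measurable W)
    (hcont : ∀ c : ℝ, P {ω | W ω = c} = 0) (c : ℝ) :
    P.map W {c} = 0 := by
  rw [Measure.map_apply hW (measurableSet_singleton c)]
  exact hcont c

section

variable {P : Measure Ω} [IsProbabilityMeasure P] {W : Ω → ℝ}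

lemma measure_cdfTransform_le (hW : Measurable W) (hcont : ∀ c : ℝ, P {ω | W ω = c} = 0) {l : ℝ}
    (hl : l ∈ Ioo (0 : ℝ) 1) : P {ω | cdfTransform P W ω ≤ l} = ENNReal.ofReal l := by
  have := Measure.isProbabilityMeasure_map (μ := P) hW.aemeasurable
  rw [← measure_cdf_le (map_singleton_eq_zero hW hcont) hl, Measure.map_apply hW]
  · rfl
  · exact measurableSet_le (monotone_cdf _).measurable measurable_const

lemma isProbabilityMeasure_tailMeasure (hW : Measurable W)
    (hcont : ∀ c : ℝ, P {ω | W ω = c} = 0) {l : ℝ} (hl : l ∈ Ioo (0 : ℝ) 1) :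
    IsProbabilityMeasure (tailMeasure P W l) := by
  constructor
  rw [tailMeasure, Measure.smul_apply, Measure.restrict_apply_univ,
    measure_cdfTransform_le hW hcont hl, smul_eq_mul, ← ENNReal.ofReal_mul (by simpa using hl.1.le),
    inv_mul_cancel₀ hl.1.ne', ENNReal.ofReal_one]

lemma tailMeasure_mem_tailSet (hW : Measurable W)
    (hcont : ∀ c : ℝ, P {ω | W ω = c} = 0) {l : ℝ} (hl : l ∈ Ioo (0 : ℝ) 1) :
    tailMeasure P W l ∈ tailSet P l := by
  refine mem_tailSet_iff.2 ⟨isProbabilityMeasure_tailMeasure hW hcont hl, ?_⟩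
  intro s
  simp only [tailMeasure, Measure.smul_apply, smul_eq_mul]
  gcongr
  exact Measure.restrict_le_self

lemma self_mem_tailSet {l : ℝ} (hl : l ∈ Ioc (0 : ℝ) 1) : P ∈ tailSet P l := by
  refine mem_tailSet_iff.2 ⟨inferInstance, fun s => ?_⟩
  simp only [Measure.smul_apply, smul_eq_mul]
  refine le_mul_of_one_le_left zero_le ?_
  rw [← ENNReal.ofReal_one]
  exact ENNReal.ofReal_le_ofReal ((one_le_inv₀ hl.1).2 hl.2)

lemma extExp_tailMeasure_le (hW : Measurable W) (hcont : ∀ c : ℝ, P {ω | W ω = c} = 0) {f : ℝ → ℝ}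
    (hf : Monotone f) (hfW : Integrable (fun ω => f (W ω)) P) {l : ℝ} (hl : l ∈ Ioo (0 : ℝ) 1)
    {Q : Measure Ω} (hQ : Q ∈ tailSet P l) :
    extExp (tailMeasure P W l) (fun ω => f (W ω)) ≤ extExp Q (fun ω => f (W ω)) := by
  obtain ⟨hQ1, hQ2⟩ := mem_tailSet_iff.1 hQ
  have hp : IsProbabilityMeasure (ENNReal.ofReal l⁻¹ • P.restrict {ω | cdfTransform P W ω ≤ l}) :=
    isProbabilityMeasure_tailMeasure hW hcont hl
  have hi : Integrable (fun ω => f (W ω)) (tailMeasure P W l) :=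
    hfW.restrict.smul_measure ENNReal.ofReal_ne_top
  rw [extExp_of_integrable hi,
    extExp_of_integrable ((hfW.smul_measure ENNReal.ofReal_ne_top).mono_measure hQ2),
    EReal.coe_le_coe_iff]
  set S := {ω | cdfTransform P W ω ≤ l} with hS
  have hmono : ∀ ω ∈ S, ∀ ω' ∉ S, f (W ω) ≤ f (W ω') := by
    intro ω hω ω' hω'
    exact hf (lt_of_cdfTransform_lt (P := P) (lt_of_le_of_lt hω (not_le.1 hω'))).le
  have hPS : P S = ENNReal.ofReal l := measure_cdfTransform_le hW hcont hl
  have hne : S.Nonempty := by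
    refine nonempty_of_measure_ne_zero (μ := P) ?_
    rw [hPS]
    simpa using hl.1
  obtain ⟨ω₁, hω₁⟩ : ∃ ω, ω ∉ S := by
    by_contra! h
    rw [eq_univ_of_forall h, measure_univ, eq_comm, ENNReal.ofReal_eq_one] at hPS
    exact hl.2.ne hPS
  have hbdd : BddAbove ((fun ω => f (W ω)) '' S) :=
    ⟨f (W ω₁), by rintro _ ⟨ω, hω, rfl⟩; exact hmono ω hω ω₁ hω₁⟩
  -- The threshold is the supremum of `f(W)` over the tail. It is finite because `P S = l < 1`
  -- leaves a point outside `S`, where `f(W)` is an upper bound.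
  exact integral_smul_restrict_le_of_threshold (measurableSet_cdfTransform_le P hW l)
    ENNReal.ofReal_ne_top hQ2 hfW (t := sSup ((fun ω => f (W ω)) '' S))
    (fun ω hω => le_csSup hbdd ⟨ω, hω, rfl⟩)
    (fun ω hω => csSup_le (hne.image _) (by rintro _ ⟨ω', hω', rfl⟩; exact hmono ω' hω' ω hω))

lemma tailUtility_eq (hW : Measurable W) (hcont : ∀ c : ℝ, P {ω | W ω = c} = 0) {f : ℝ → ℝ}
    (hf : Monotone f) (hfW : Integrable (fun ω => f (W ω)) P) {l : ℝ} (hl : l ∈ Ioo (0 : ℝ) 1) :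
    tailUtility P l (fun ω => f (W ω)) = extExp (tailMeasure P W l) (fun ω => f (W ω)) :=
  le_antisymm (iInf₂_le _ (tailMeasure_mem_tailSet hW hcont hl))
    (le_iInf₂ fun _ hQ => extExp_tailMeasure_le hW hcont hf hfW hl hQ)

end

lemma restrict_Ioc_eq_self {μ : Measure ℝ} (hμ : ∀ᵐ l ∂μ, l ∈ Ioo (0 : ℝ) 1) :
    μ.restrict (Ioc 0 1) = μ :=
  Measure.restrict_eq_self_of_ae_mem (hμ.mono fun _ hl => Ioo_subset_Ioc_self hl)

lemma weightedUtility_eq_extIntegral {P : Measure Ω} {μ : Measure ℝ}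
    (hμ : ∀ᵐ l ∂μ, l ∈ Ioo (0 : ℝ) 1) (Y : Ω → ℝ) :
    weightedUtility P μ Y = extIntegral μ fun l => tailUtility P l Y := by
  rw [weightedUtility, restrict_Ioc_eq_self hμ]

/-- `g` is bounded on `[0, 1]`, so the spectral measure is dominated by a multiple of `P`. -/
lemma integrable_spectralMeasure {P : Measure Ω} {W : Ω → ℝ} {g : ℝ → ℝ}
    (hgc : Continuous g) {Y : Ω → ℝ}
    (hY : Integrable Y P) : Integrable Y (spectralMeasure P W g) := by
  obtain ⟨C, hC⟩ := isCompact_Icc.exists_bound_of_continuousOn (hgc.continuousOn (s := Icc 0 1))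
  have hle : spectralMeasure P W g ≤ ENNReal.ofReal C • P := by
    rw [spectralMeasure, ← withDensity_const]
    refine withDensity_mono (ae_of_all _ fun ω => ENNReal.ofReal_le_ofReal ?_)
    exact (le_abs_self _).trans (hC _ (cdfTransform_mem P W ω))
  exact (hY.smul_measure ENNReal.ofReal_ne_top).mono_measure hle

/-! ### The spectral measure as a mixture of tail minimizers. -/

section Mixture

variable {P : Measure Ω} [IsProbabilityMeasure P] {W : Ω → ℝ}
  {μ : Measure ℝ} [IsProbabilityMeasure μ] {g : ℝ → ℝ}

/-- Tonelli on the region `{F(W) ≤ l}`: by `hg`, integrating `l⁻¹` over this region in `l` produces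
the density `g(F(W))`. -/
lemma lintegral_spectralMeasure (hW : Measurable W) (hgm : Measurable g)
    (hg : ∀ u ∈ Icc (0 : ℝ) 1, ∫⁻ l in Ici u, ENNReal.ofReal l⁻¹ ∂μ = ENNReal.ofReal (g u))
    {h : Ω → ℝ≥0∞} (hh : Measurable h) :
    ∫⁻ ω, h ω ∂(spectralMeasure P W g) = ∫⁻ l, ∫⁻ ω, h ω ∂(tailMeasure P W l) ∂μ := by
  have hU := measurable_cdfTransform P hW
  have hm : Measurable (Function.uncurry fun (ω : Ω) (l : ℝ) =>
      {p : Ω × ℝ | cdfTransform P W p.1 ≤ p.2}.indicator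
        (fun p => ENNReal.ofReal p.2⁻¹ * h p.1) (ω, l)) := by
    refine Measurable.indicator ?_ (measurableSet_le (hU.comp measurable_fst) measurable_snd)
    exact (measurable_snd.inv.ennreal_ofReal).mul (hh.comp measurable_fst)
  rw [spectralMeasure, lintegral_withDensity_eq_lintegral_mul _
    (show Measurable fun ω => ENNReal.ofReal (g (cdfTransform P W ω)) from
      (hgm.comp hU).ennreal_ofReal) hh]
  calc ∫⁻ ω, ((fun ω => ENNReal.ofReal (g (cdfTransform P W ω))) * h) ω ∂P
      = ∫⁻ ω, ∫⁻ l, {p : Ω × ℝ | cdfTransform P W p.1 ≤ p.2}.indicator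
        (fun p => ENNReal.ofReal p.2⁻¹ * h p.1) (ω, l) ∂μ ∂P := by
        refine lintegral_congr fun ω => ?_
        rw [Pi.mul_apply, ← hg _ (cdfTransform_mem P W ω), ← lintegral_indicator measurableSet_Ici,
          ← lintegral_mul_const _ ((measurable_inv.ennreal_ofReal).indicator measurableSet_Ici)]
        refine lintegral_congr fun l => ?_
        by_cases hl : cdfTransform P W ω ≤ l <;> simp [indicator, hl]
    _ = ∫⁻ l, ∫⁻ ω, {p : Ω × ℝ | cdfTransform P W p.1 ≤ p.2}.indicator
        (fun p => ENNReal.ofReal p.2⁻¹ * h p.1) (ω, l) ∂P ∂μ :=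
        lintegral_lintegral_swap hm.aemeasurable
    _ = ∫⁻ l, ∫⁻ ω, h ω ∂(tailMeasure P W l) ∂μ := by
        refine lintegral_congr fun l => ?_
        rw [tailMeasure, lintegral_smul_measure, smul_eq_mul,
          ← lintegral_indicator (measurableSet_cdfTransform_le P hW l),
          ← lintegral_const_mul _ (hh.indicator (measurableSet_cdfTransform_le P hW l))]
        refine lintegral_congr fun ω => ?_
        by_cases hl : cdfTransform P W ω ≤ l <;> simp [indicator, hl]

lemma measurable_lintegral_tailMeasure (hW : Measurable W) {h : Ω → ℝ≥0∞} (hh : Measurable h) :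
    Measurable fun l => ∫⁻ ω, h ω ∂(tailMeasure P W l) := by
  have hU := measurable_cdfTransform P hW
  have hm : Measurable (Function.uncurry fun (l : ℝ) (ω : Ω) =>
      {p : ℝ × Ω | cdfTransform P W p.2 ≤ p.1}.indicator (fun p => h p.2) (l, ω)) :=
    Measurable.indicator (hh.comp measurable_snd)
      (measurableSet_le (hU.comp measurable_snd) measurable_fst)
  have : (fun l => ∫⁻ ω, h ω ∂(tailMeasure P W l)) = fun l => ENNReal.ofReal l⁻¹ *
      ∫⁻ ω, {p : ℝ × Ω | cdfTransform P W p.2 ≤ p.1}.indicator (fun p => h p.2) (l, ω) ∂P := by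
    funext l
    rw [tailMeasure, lintegral_smul_measure, smul_eq_mul,
      ← lintegral_indicator (measurableSet_cdfTransform_le P hW l)]
    rfl
  rw [this]
  exact (measurable_inv.ennreal_ofReal).mul hm.lintegral_prod_right

lemma isProbabilityMeasure_spectralMeasure (hW : Measurable W)
    (hcont : ∀ c : ℝ, P {ω | W ω = c} = 0) (hμ : ∀ᵐ l ∂μ, l ∈ Ioo (0 : ℝ) 1) (hgm : Measurable g)
    (hg : ∀ u ∈ Icc (0 : ℝ) 1, ∫⁻ l in Ici u, ENNReal.ofReal l⁻¹ ∂μ = ENNReal.ofReal (g u)) :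
    IsProbabilityMeasure (spectralMeasure P W g) := by
  constructor
  have h := lintegral_spectralMeasure (P := P) hW hgm hg (h := fun _ => 1) measurable_const
  rw [lintegral_one] at h
  rw [h]
  calc ∫⁻ l, ∫⁻ _, 1 ∂(tailMeasure P W l) ∂μ = ∫⁻ _, 1 ∂μ := by
        refine lintegral_congr_ae (hμ.mono fun l hl => ?_)
        have := isProbabilityMeasure_tailMeasure hW hcont hl
        simp
    _ = 1 := by simp

lemma extIntegral_extExp_tailMeasure (hW : Measurable W) (hgm : Measurable g)
    (hg : ∀ u ∈ Icc (0 : ℝ) 1, ∫⁻ l in Ici u, ENNReal.ofReal l⁻¹ ∂μ = ENNReal.ofReal (g u))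
    {Y : Ω → ℝ} (hY : Measurable Y) (hYi : Integrable Y (spectralMeasure P W g)) :
    extIntegral μ (fun l => extExp (tailMeasure P W l) Y) = extExp (spectralMeasure P W g) Y := by
  have h1 := lintegral_spectralMeasure (P := P) hW hgm hg hY.ennreal_ofReal
  have h2 := lintegral_spectralMeasure (P := P) hW hgm hg hY.neg.ennreal_ofReal
  simp only [Pi.neg_apply] at h2
  simp only [extExp_eq]
  rw [h1, h2]
  refine extIntegral_coe_sub (measurable_lintegral_tailMeasure hW hY.ennreal_ofReal).aemeasurable
    (measurable_lintegral_tailMeasure hW hY.neg.ennreal_ofReal).aemeasurable ?_ ?_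
  · rw [← h1]
    exact hYi.lintegral_lt_top.ne
  · rw [← h2]
    exact hYi.neg.lintegral_lt_top.ne

/-- For an increasing function of `W` the utility is attained at the spectral measure of `W`. -/
lemma weightedUtility_comp_eq (hW : Measurable W)
    (hcont : ∀ c : ℝ, P {ω | W ω = c} = 0) (hμ : ∀ᵐ l ∂μ, l ∈ Ioo (0 : ℝ) 1) (hgc : Continuous g)
    (hg : ∀ u ∈ Icc (0 : ℝ) 1, ∫⁻ l in Ici u, ENNReal.ofReal l⁻¹ ∂μ = ENNReal.ofReal (g u))
    {f : ℝ → ℝ} (hf : Monotone f) (hfW : Integrable (fun ω => f (W ω)) P) :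
    weightedUtility P μ (fun ω => f (W ω)) =
      ((∫ ω, f (W ω) ∂(spectralMeasure P W g) : ℝ) : EReal) := by
  have hi := integrable_spectralMeasure (W := W) hgc hfW
  rw [weightedUtility_eq_extIntegral hμ, ← extExp_of_integrable hi,
    ← extIntegral_extExp_tailMeasure hW hgc.measurable hg
      (show Measurable fun ω => f (W ω) from hf.measurable.comp hW) hi]
  exact extIntegral_congr_ae (hμ.mono fun l hl => tailUtility_eq hW hcont hf hfW hl)

/-- This puts the spectral measure in the determining set. For integrable `Y` it is the mixture
formula, since each tail utility is at most the mean under the tail minimizer. -/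
lemma weightedUtility_le_extExp_spectralMeasure (hW : Measurable W)
    (hcont : ∀ c : ℝ, P {ω | W ω = c} = 0) (hμ : ∀ᵐ l ∂μ, l ∈ Ioo (0 : ℝ) 1) (hgc : Continuous g)
    (hg : ∀ u ∈ Icc (0 : ℝ) 1, ∫⁻ l in Ici u, ENNReal.ofReal l⁻¹ ∂μ = ENNReal.ofReal (g u))
    {Y : Ω → ℝ} (hY : Measurable Y) :
    weightedUtility P μ Y ≤ extExp (spectralMeasure P W g) Y := by
  rw [weightedUtility_eq_extIntegral hμ]
  -- `P` lies in every tail set, so if the negative part of `Y` has infinite `P`-mean then every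
  -- tail utility is `⊥`.
  by_cases hneg : ∫⁻ ω, ENNReal.ofReal (-Y ω) ∂P = ∞
  · have hbot : extExp P Y = ⊥ := by
      rw [extExp_eq, hneg, EReal.coe_ennreal_top, EReal.sub_top]
    have hle : extIntegral μ (fun l => tailUtility P l Y) ≤ extIntegral μ (fun _ => ⊥) :=
      extIntegral_mono_ae (hμ.mono fun l hl =>
        (iInf₂_le P (self_mem_tailSet (Ioo_subset_Ioc_self hl))).trans hbot.le)
    refine hle.trans ?_
    simp [extIntegral]
  have hQneg : ∫⁻ ω, ENNReal.ofReal (-Y ω) ∂(spectralMeasure P W g) ≠ ∞ := by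
    have hi : Integrable (fun ω => max (-Y ω) 0) P := by
      refine ⟨(hY.neg.max measurable_const).aestronglyMeasurable, ?_⟩
      rw [hasFiniteIntegral_iff_ofReal (ae_of_all P fun ω => le_max_right (-Y ω) 0)]
      simpa [ENNReal.ofReal_max, lt_top_iff_ne_top] using hneg
    simpa using (integrable_spectralMeasure hgc hi).lintegral_lt_top.ne
  by_cases hpos : ∫⁻ ω, ENNReal.ofReal (Y ω) ∂(spectralMeasure P W g) = ∞
  · rw [extExp_eq, hpos, EReal.coe_ennreal_top, EReal.top_sub (by simpa using hQneg)]
    exact le_top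
  have hi : Integrable Y (spectralMeasure P W g) := by
    refine integrable_of_extExp_ne hY.aestronglyMeasurable ?_ ?_
    all_goals
      rw [extExp_eq, ← EReal.coe_ennreal_toReal hpos, ← EReal.coe_ennreal_toReal hQneg,
        ← EReal.coe_sub]
    · exact EReal.coe_ne_bot _
    · exact EReal.coe_ne_top _
  rw [← extIntegral_extExp_tailMeasure hW hgc.measurable hg hY hi]
  exact extIntegral_mono_ae (hμ.mono fun l hl => iInf₂_le _ (tailMeasure_mem_tailSet hW hcont hl))

end Mixture

/-! ### Uniqueness of the extreme measure. -/

section Uniqueness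

variable {Ω : Type*} [MeasurableSpace Ω]

lemma extExp_neg_indicator (Q : Measure Ω) {A : Set Ω} (hA : MeasurableSet A) :
    extExp Q (fun ω => -A.indicator 1 ω) = 0 - (Q A : EReal) := by
  have h1 : ∫⁻ ω, ENNReal.ofReal (-A.indicator 1 ω) ∂Q = 0 := by
    rw [← lintegral_zero (μ := Q)]
    refine lintegral_congr fun ω => ?_
    by_cases h : ω ∈ A <;> simp [h]
  have h2 : ∫⁻ ω, ENNReal.ofReal (-(-A.indicator 1 ω)) ∂Q = Q A := by
    rw [← lintegral_indicator_one hA]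
    refine lintegral_congr fun ω => ?_
    by_cases h : ω ∈ A <;> simp [h]
  rw [extExp_eq, h1, h2, EReal.coe_ennreal_zero]

variable {P : Measure Ω} [IsProbabilityMeasure P] {W : Ω → ℝ}
  {μ : Measure ℝ} [IsProbabilityMeasure μ] {g : ℝ → ℝ}

/-- If `F(c) ≤ l`, then `{W ≤ c}` lies in the tail, where the minimizer already has the maximal
density `1/l`. If `l < F(c)`, the minimizer gives `{W ≤ c}` mass one and the bound is trivial. -/
lemma tailSet_apply_union_le (hW : Measurable W) (hcont : ∀ c : ℝ, P {ω | W ω = c} = 0) {l : ℝ}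
    (hl : l ∈ Ioo (0 : ℝ) 1) {R : Measure Ω} (hR : R ∈ tailSet P l) (c : ℝ) (B : Set Ω) :
    R ({ω | W ω ≤ c} ∪ B) ≤ tailMeasure P W l {ω | W ω ≤ c} +
      (Ici (cdf (P.map W) c)).indicator (fun l => ENNReal.ofReal l⁻¹) l * P B := by
  obtain ⟨h1, h2⟩ := mem_tailSet_iff.1 hR
  by_cases hcl : cdf (P.map W) c ≤ l
  · have hsub : {ω | W ω ≤ c} ⊆ {ω | cdfTransform P W ω ≤ l} := fun ω hω =>
      (monotone_cdf (P.map W) hω).trans hcl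
    rw [indicator_of_mem (by exact hcl), tailMeasure, Measure.smul_apply,
      Measure.restrict_apply (measurableSet_le hW measurable_const), inter_eq_left.2 hsub]
    calc R ({ω | W ω ≤ c} ∪ B) ≤ R {ω | W ω ≤ c} + R B := measure_union_le _ _
      _ ≤ _ := add_le_add (h2 _) (h2 _)
  · have hp := isProbabilityMeasure_tailMeasure hW hcont hl
    have hone : tailMeasure P W l {ω | W ω ≤ c} = 1 := by
      rw [← prob_compl_eq_zero_iff (measurableSet_le hW measurable_const), tailMeasure,
        Measure.smul_apply, Measure.restrict_apply (measurableSet_le hW measurable_const).compl]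
      have hempty : {ω | W ω ≤ c}ᶜ ∩ {ω | cdfTransform P W ω ≤ l} = ∅ := by
        refine eq_empty_of_forall_notMem fun ω hω => hω.1 ?_
        exact (lt_of_cdfTransform_lt (lt_of_le_of_lt hω.2 (not_le.1 hcl))).le
      rw [hempty, measure_empty, smul_zero]
    rw [hone]
    exact prob_le_one.trans le_self_add

/-- The bound for tail sets integrated over `μ`; it reaches `Q` through the test variable `-1_A`,
whose utility is at least minus the integrated bound. -/
lemma determiningSet_apply_union_le (hW : Measurable W)
    (hcont : ∀ c : ℝ, P {ω | W ω = c} = 0) (hμ : ∀ᵐ l ∂μ, l ∈ Ioo (0 : ℝ) 1) (hgm : Measurable g)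
    (hg : ∀ u ∈ Icc (0 : ℝ) 1, ∫⁻ l in Ici u, ENNReal.ofReal l⁻¹ ∂μ = ENNReal.ofReal (g u))
    {Q : Measure Ω} (hQ : Q ∈ determiningSet P (weightedUtility P μ)) (c : ℝ) {B : Set Ω}
    (hB : MeasurableSet B) :
    Q ({ω | W ω ≤ c} ∪ B) ≤ spectralMeasure P W g {ω | W ω ≤ c} +
      ENNReal.ofReal (g (cdf (P.map W) c)) * P B := by
  have := isProbabilityMeasure_spectralMeasure hW hcont hμ hgm hg
  have hWc : MeasurableSet {ω | W ω ≤ c} := measurableSet_le hW measurable_const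
  have hA : MeasurableSet ({ω | W ω ≤ c} ∪ B) := hWc.union hB
  have hD := hQ.2 _ ((measurable_one.indicator hA).neg)
  change _ ≤ extExp Q (fun ω => -({ω | W ω ≤ c} ∪ B).indicator 1 ω) at hD
  set h : ℝ → ℝ≥0∞ := fun l => tailMeasure P W l {ω | W ω ≤ c} +
    (Ici (cdf (P.map W) c)).indicator (fun l => ENNReal.ofReal l⁻¹) l * P B with hh
  have hm1 : Measurable fun l => tailMeasure P W l {ω | W ω ≤ c} := by
    have := measurable_lintegral_tailMeasure (P := P) hW
      ((measurable_const (a := (1 : ℝ≥0∞))).indicator hWc)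
    simpa only [lintegral_indicator hWc, setLIntegral_one] using this
  have hm2 : Measurable fun l => (Ici (cdf (P.map W) c)).indicator
      (fun l => ENNReal.ofReal l⁻¹) l := measurable_inv.ennreal_ofReal.indicator measurableSet_Ici
  have hint : ∫⁻ l, h l ∂μ = spectralMeasure P W g {ω | W ω ≤ c} +
      ENNReal.ofReal (g (cdf (P.map W) c)) * P B := by
    rw [hh, lintegral_add_left hm1, lintegral_mul_const _ hm2,
      lintegral_indicator measurableSet_Ici, hg _ ⟨cdf_nonneg _ _, cdf_le_one _ _⟩]
    have := lintegral_spectralMeasure (P := P) hW hgm hg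
      ((measurable_const (a := (1 : ℝ≥0∞))).indicator hWc)
    simp only [lintegral_indicator hWc, setLIntegral_one] at this
    rw [this]
  have hfin : ∫⁻ l, h l ∂μ ≠ ∞ := by
    rw [hint]
    exact ENNReal.add_ne_top.2
      ⟨measure_ne_top _ _, ENNReal.mul_ne_top ENNReal.ofReal_ne_top (measure_ne_top _ _)⟩
  rw [← hint]
  have hlow : 0 - ((∫⁻ l, h l ∂μ : ℝ≥0∞) : EReal) ≤
      weightedUtility P μ (fun ω => -({ω | W ω ≤ c} ∪ B).indicator 1 ω) := by
    have e := extIntegral_coe_sub (Q := μ) (a := fun _ => 0) (b := h) aemeasurable_const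
      (hm1.add (hm2.mul_const _)).aemeasurable (by simp) hfin
    rw [lintegral_zero, EReal.coe_ennreal_zero] at e
    rw [← e, weightedUtility_eq_extIntegral hμ]
    refine extIntegral_mono_ae (hμ.mono fun l hl => le_iInf₂ fun R hR => ?_)
    rw [extExp_neg_indicator R hA]
    exact EReal.sub_le_sub le_rfl
      (EReal.coe_ennreal_le_coe_ennreal_iff.2 (tailSet_apply_union_le hW hcont hl hR c B))
  have hfinal := hlow.trans hD
  rw [extExp_neg_indicator Q hA, zero_sub, zero_sub, EReal.neg_le_neg_iff] at hfinal
  exact EReal.coe_ennreal_le_coe_ennreal_iff.1 hfinal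

lemma integral_comp_spectralMeasure_le (hW : Measurable W)
    (hcont : ∀ c : ℝ, P {ω | W ω = c} = 0) (hμ : ∀ᵐ l ∂μ, l ∈ Ioo (0 : ℝ) 1) (hgc : Continuous g)
    (hg : ∀ u ∈ Icc (0 : ℝ) 1, ∫⁻ l in Ici u, ENNReal.ofReal l⁻¹ ∂μ = ENNReal.ofReal (g u))
    {Q : Measure Ω} (hQ : Q ∈ determiningSet P (weightedUtility P μ)) {f : ℝ → ℝ}
    (hf : Monotone f) (hfP : Integrable (fun ω => f (W ω)) P)
    (hfQ : Integrable (fun ω => f (W ω)) Q) :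
    ∫ ω, f (W ω) ∂(spectralMeasure P W g) ≤ ∫ ω, f (W ω) ∂Q := by
  have h := hQ.2 (fun ω => f (W ω)) (hf.measurable.comp hW)
  rw [weightedUtility_comp_eq hW hcont hμ hgc hg hf hfP, extExp_of_integrable hfQ,
    EReal.coe_le_coe_iff] at h
  exact h

/-- Adding `K w` to `φ` or to `-φ` makes it increasing. The two resulting inequalities, with equal
means of `W`, pin down `E φ(W)`. -/
lemma map_eq_map_spectralMeasure (hW : Measurable W) (hWi : Integrable W P)
    (hcont : ∀ c : ℝ, P {ω | W ω = c} = 0) (hμ : ∀ᵐ l ∂μ, l ∈ Ioo (0 : ℝ) 1) (hgc : Continuous g)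
    (hg : ∀ u ∈ Icc (0 : ℝ) 1, ∫⁻ l in Ici u, ENNReal.ofReal l⁻¹ ∂μ = ENNReal.ofReal (g u))
    {Q : Measure Ω} (hQ : Q ∈ determiningSet P (weightedUtility P μ)) (hWQ : Integrable W Q)
    (hQW : ∫ ω, W ω ∂Q = ∫ ω, W ω ∂(spectralMeasure P W g)) :
    Q.map W = (spectralMeasure P W g).map W := by
  have hS := isProbabilityMeasure_spectralMeasure hW hcont hμ hgc.measurable hg
  have hQp : IsProbabilityMeasure Q := hQ.1.1
  have := Measure.isProbabilityMeasure_map (μ := Q) hW.aemeasurable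
  have := Measure.isProbabilityMeasure_map (μ := spectralMeasure P W g) hW.aemeasurable
  have hWS := integrable_spectralMeasure (W := W) hgc hWi
  have key : ∀ (φ : BoundedContinuousFunction ℝ ℝ) (K : NNReal), LipschitzWith K φ →
      ∫ x, φ x ∂(Q.map W) = ∫ x, φ x ∂((spectralMeasure P W g).map W) := by
    intro φ K hφ
    have hi : ∀ (R : Measure Ω) [IsProbabilityMeasure R], Integrable (fun ω => φ (W ω)) R := by
      intro R _
      refine Integrable.of_bound (φ.continuous.measurable.comp hW).aestronglyMeasurable ‖φ‖
        (ae_of_all _ fun ω => φ.norm_coe_le_norm _)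
    have hlip : ∀ x y, x ≤ y → |φ x - φ y| ≤ K * (y - x) := by
      intro x y hxy
      have := hφ.dist_le_mul x y
      rwa [Real.dist_eq, Real.dist_eq, abs_sub_comm x y, abs_of_nonneg (sub_nonneg.2 hxy)] at this
    have h1 := integral_comp_spectralMeasure_le hW hcont hμ hgc hg hQ
      (f := fun w => K * w + φ w)
      (fun x y hxy => by
        have := (abs_le.1 (hlip x y hxy)).2
        simp only
        linarith)
      ((hWi.const_mul _).add (hi P)) ((hWQ.const_mul _).add (hi Q))
    have h2 := integral_comp_spectralMeasure_le hW hcont hμ hgc hg hQ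
      (f := fun w => K * w - φ w)
      (fun x y hxy => by
        have := (abs_le.1 (hlip x y hxy)).1
        simp only
        linarith)
      ((hWi.const_mul _).sub (hi P)) ((hWQ.const_mul _).sub (hi Q))
    rw [integral_add (hWQ.const_mul _) (hi Q), integral_add (hWS.const_mul _) (hi _),
      integral_const_mul, integral_const_mul, hQW] at h1
    rw [integral_sub (hWQ.const_mul _) (hi Q), integral_sub (hWS.const_mul _) (hi _),
      integral_const_mul, integral_const_mul, hQW] at h2
    rw [integral_map hW.aemeasurable φ.continuous.aestronglyMeasurable,
      integral_map hW.aemeasurable φ.continuous.aestronglyMeasurable]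
    linarith
  -- Closed sets are reached as limits of thickened indicators, which are Lipschitz.
  refine ext_of_generate_finite _ ?_ isPiSystem_isClosed ?_ (by simp)
  · rw [BorelSpace.measurable_eq (α := ℝ), borel_eq_generateFrom_isClosed]
  intro F hF
  have hpos : ∀ n : ℕ, 0 < 1 / ((n : ℝ) + 1) := fun n => Nat.one_div_pos_of_nat
  have t1 := tendsto_integral_thickenedIndicator_of_isClosed (Q.map W) hF hpos
    tendsto_one_div_add_atTop_nhds_zero_nat
  have t2 := tendsto_integral_thickenedIndicator_of_isClosed ((spectralMeasure P W g).map W) hF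
    hpos tendsto_one_div_add_atTop_nhds_zero_nat
  have e : ∀ n, ∫ x, (thickenedIndicator (hpos n) F x : ℝ) ∂(Q.map W) =
      ∫ x, (thickenedIndicator (hpos n) F x : ℝ) ∂((spectralMeasure P W g).map W) := by
    intro n
    have hlip := lipschitzWith_thickenedIndicator (hpos n) F
    have hcoe : LipschitzWith 1 ((↑) : NNReal → ℝ) := LipschitzWith.subtype_val _
    exact key ((thickenedIndicator (hpos n) F).comp _ hcoe) _ (hcoe.comp hlip)
  simp only [e] at t1
  exact (measureReal_eq_measureReal_iff).1 (tendsto_nhds_unique t1 t2)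

/-- With equal laws of `W`, the mass of `{W ≤ c}` cancels from the union bound. What remains caps
the density of `Q` by `g(F(c))` on `{W > c}`. -/
lemma le_spectralMeasure_of_map_eq (hW : Measurable W)
    (hcont : ∀ c : ℝ, P {ω | W ω = c} = 0) (hμ : ∀ᵐ l ∂μ, l ∈ Ioo (0 : ℝ) 1) (hgc : Continuous g)
    (hg : ∀ u ∈ Icc (0 : ℝ) 1, ∫⁻ l in Ici u, ENNReal.ofReal l⁻¹ ∂μ = ENNReal.ofReal (g u))
    {Q : Measure Ω} (hQ : Q ∈ determiningSet P (weightedUtility P μ))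
    (hmap : Q.map W = (spectralMeasure P W g).map W) : Q ≤ spectralMeasure P W g := by
  have hS := isProbabilityMeasure_spectralMeasure hW hcont hμ hgc.measurable hg
  have hQp : IsProbabilityMeasure Q := hQ.1.1
  have hbound : ∀ c : ℝ, ∀ B, MeasurableSet B → B ⊆ {ω | c < W ω} →
      Q B ≤ ENNReal.ofReal (g (cdf (P.map W) c)) * P B := by
    intro c B hB hBc
    have h := determiningSet_apply_union_le hW hcont hμ hgc.measurable hg hQ c hB
    have hdisj : Disjoint {ω | W ω ≤ c} B := by
      rw [Set.disjoint_left]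
      intro ω h1 h2
      exact (show c < W ω from hBc h2).not_ge h1
    have heq : Q {ω | W ω ≤ c} = spectralMeasure P W g {ω | W ω ≤ c} := by
      have := congrArg (fun ν : Measure ℝ => ν (Iic c)) hmap
      simp only [Measure.map_apply hW measurableSet_Iic] at this
      exact this
    rw [measure_union hdisj hB, heq] at h
    exact (ENNReal.add_le_add_iff_left (measure_ne_top _ _)).1 h
  have hae : ∀ c : ℝ, ∀ᵐ ω ∂P, c < W ω →
      Q.rnDeriv P ω ≤ ENNReal.ofReal (g (cdf (P.map W) c)) := by
    intro c
    have hWc : MeasurableSet {ω | c < W ω} := measurableSet_lt measurable_const hW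
    refine (ae_restrict_iff' hWc).1 ?_
    refine ae_le_of_forall_setLIntegral_le_of_sigmaFinite (Measure.measurable_rnDeriv Q P)
      fun s hs _ => ?_
    rw [Measure.restrict_restrict hs, Measure.setLIntegral_rnDeriv hQ.1.2, setLIntegral_const]
    exact hbound c _ (hs.inter hWc) inter_subset_right
  have hdens : Q.rnDeriv P ≤ᵐ[P] fun ω => ENNReal.ofReal (g (cdfTransform P W ω)) := by
    -- The exceptional null set depends on `c`, so only rational levels are used; continuity of `g ∘
    -- F` recovers the level `W ω` from below.
    have hall : ∀ᵐ ω ∂P, ∀ q : ℚ, (q : ℝ) < W ω →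
        Q.rnDeriv P ω ≤ ENNReal.ofReal (g (cdf (P.map W) q)) :=
      ae_all_iff.2 fun q => hae q
    filter_upwards [hall] with ω hω
    have := Measure.isProbabilityMeasure_map (μ := P) hW.aemeasurable
    have hc : Continuous fun c => ENNReal.ofReal (g (cdf (P.map W) c)) :=
      ENNReal.continuous_ofReal.comp
        (hgc.comp (continuous_cdf (map_singleton_eq_zero hW hcont)))
    by_contra! hlt
    have hnear := (hc.tendsto (W ω)).eventually (gt_mem_nhds hlt)
    obtain ⟨a, ha, ha'⟩ := exists_Ioc_subset_of_mem_nhds hnear ⟨W ω - 1, by linarith⟩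
    obtain ⟨q, hq1, hq2⟩ := exists_rat_btwn ha
    exact absurd (ha' ⟨hq1, hq2.le⟩) (not_lt.2 (hω q hq2))
  rw [← Measure.withDensity_rnDeriv_eq Q P hQ.1.2]
  exact withDensity_mono hdens

/-- If `W` is continuously distributed, its only extreme measure is the spectral measure. -/
lemma extremeMeasures_weightedUtility (hW : Measurable W) (hWi : Integrable W P)
    (hcont : ∀ c : ℝ, P {ω | W ω = c} = 0) (hμ : ∀ᵐ l ∂μ, l ∈ Ioo (0 : ℝ) 1) (hgc : Continuous g)
    (hg : ∀ u ∈ Icc (0 : ℝ) 1, ∫⁻ l in Ici u, ENNReal.ofReal l⁻¹ ∂μ = ENNReal.ofReal (g u)) :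
    extremeMeasures P (weightedUtility P μ) W = {spectralMeasure P W g} := by
  have hS := isProbabilityMeasure_spectralMeasure hW hcont hμ hgc.measurable hg
  have hWS := integrable_spectralMeasure (W := W) hgc hWi
  have hu : weightedUtility P μ W = ((∫ ω, W ω ∂(spectralMeasure P W g) : ℝ) : EReal) :=
    weightedUtility_comp_eq hW hcont hμ hgc hg (f := fun w => w) (fun _ _ h => h) hWi
  ext Q
  rw [mem_singleton_iff]
  constructor
  · rintro ⟨hQ, hQW, hne⟩
    have hQp : IsProbabilityMeasure Q := hQ.1.1
    have hWQ : Integrable W Q :=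
      integrable_of_extExp_ne hW.aestronglyMeasurable (by rw [hQW]; exact hne.1)
        (by rw [hQW]; exact hne.2)
    rw [hu, extExp_of_integrable hWQ, EReal.coe_eq_coe_iff] at hQW
    have hmap := map_eq_map_spectralMeasure hW hWi hcont hμ hgc hg hQ hWQ hQW
    refine Measure.eq_of_le_of_isProbabilityMeasure
      (le_spectralMeasure_of_map_eq hW hcont hμ hgc hg hQ hmap)
  · intro hQ
    subst hQ
    refine ⟨⟨⟨hS, withDensity_absolutelyContinuous _ _⟩, fun Y hY =>
      weightedUtility_le_extExp_spectralMeasure hW hcont hμ hgc hg hY⟩, ?_, ?_, ?_⟩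
    · rw [hu, extExp_of_integrable hWS]
    · rw [hu]; exact EReal.coe_ne_bot _
    · rw [hu]; exact EReal.coe_ne_top _

end Uniqueness

/-! ### The contribution as `E[g(F(W)) X]`. -/

section Contribution

variable {Ω : Type*} [MeasurableSpace Ω] {P : Measure Ω}

lemma weightedUtility_congr_ae {μ : Measure ℝ} {W V : Ω → ℝ} (h : W =ᵐ[P] V) :
    weightedUtility P μ W = weightedUtility P μ V := by
  have : ∀ l, tailUtility P l W = tailUtility P l V := fun l =>
    iInf_congr fun Q => iInf_congr fun hQ => extExp_congr_ae (hQ.1.2.ae_eq h)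
  simp only [weightedUtility, this]

lemma extremeMeasures_congr_ae {μ : Measure ℝ} {W V : Ω → ℝ} (h : W =ᵐ[P] V) :
    extremeMeasures P (weightedUtility P μ) W = extremeMeasures P (weightedUtility P μ) V := by
  ext Q
  simp only [extremeMeasures, mem_ofPred_eq, weightedUtility_congr_ae h]
  refine and_congr_right fun hQ => ?_
  rw [extExp_congr_ae (hQ.1.2.ae_eq h)]

variable [IsProbabilityMeasure P] {W : Ω → ℝ}
  {μ : Measure ℝ} [IsProbabilityMeasure μ] {g : ℝ → ℝ}

lemma utilityContribution_weightedUtility {X : Ω → ℝ} (hX : Integrable X P) (hW : Integrable W P)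
    (hcont : ∀ c : ℝ, P {ω | W ω = c} = 0) (hμ : ∀ᵐ l ∂μ, l ∈ Ioo (0 : ℝ) 1) (hgc : Continuous g)
    (hg0 : ∀ u ∈ Icc (0 : ℝ) 1, 0 ≤ g u)
    (hg : ∀ u ∈ Icc (0 : ℝ) 1, ∫⁻ l in Ici u, ENNReal.ofReal l⁻¹ ∂μ = ENNReal.ofReal (g u)) :
    utilityContribution P (weightedUtility P μ) X W =
      ((∫ ω, g (cdf (P.map W) (W ω)) * X ω ∂P : ℝ) : EReal) := by
  -- `W` is only a.e. measurable, so a measurable version takes its place. Absolute continuity of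
  -- the measures involved makes this harmless.
  obtain ⟨V, hV, hWV⟩ := hW.aestronglyMeasurable.aemeasurable
  have hcont' : ∀ c : ℝ, P {ω | V ω = c} = 0 := by
    intro c
    have hne : ∀ᵐ ω ∂P, W ω ≠ c := by simpa [ae_iff] using hcont c
    have hne' : ∀ᵐ ω ∂P, V ω ≠ c := by
      filter_upwards [hne, hWV] with ω h1 h2
      rwa [← h2]
    simpa [ae_iff] using hne'
  rw [utilityContribution, extremeMeasures_congr_ae hWV,
    extremeMeasures_weightedUtility hV (hW.congr hWV) hcont' hμ hgc hg, infExp]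
  simp only [mem_singleton_iff, iInf_iInf_eq_left]
  rw [extExp_of_integrable (integrable_spectralMeasure hgc hX), EReal.coe_eq_coe_iff,
    spectralMeasure, integral_withDensity_eq_integral_toReal_smul
      (show Measurable fun ω => ENNReal.ofReal (g (cdfTransform P V ω)) from
        (hgc.measurable.comp (measurable_cdfTransform P hV)).ennreal_ofReal) (by simp)]
  refine integral_congr_ae ?_
  rw [Measure.map_congr hWV]
  filter_upwards [hWV] with ω hω
  rw [hω, smul_eq_mul, ENNReal.toReal_ofReal (hg0 _ (cdfTransform_mem P V ω)), cdfTransform]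

end Contribution

/-! ### The beta weight and binomial tails. -/

section Beta

/-- The probability that a binomial variable with parameters `n` and `u` is less than `b`. -/
noncomputable def binomialBelow (n b : ℕ) (u : ℝ) : ℝ :=
  ∑ k ∈ Finset.range b, (bernsteinPolynomial ℝ n k).eval u

lemma continuous_binomialBelow (n b : ℕ) : Continuous (binomialBelow n b) := by
  unfold binomialBelow
  fun_prop

lemma binomialBelow_nonneg (n b : ℕ) {u : ℝ} (hu : u ∈ Icc (0 : ℝ) 1) :
    0 ≤ binomialBelow n b u := by
  refine Finset.sum_nonneg fun k _ => ?_
  have h1 : 0 ≤ u := hu.1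
  have h2 : 0 ≤ 1 - u := sub_nonneg.2 hu.2
  simp only [bernsteinPolynomial, Polynomial.eval_mul, Polynomial.eval_pow, Polynomial.eval_X,
    Polynomial.eval_sub, Polynomial.eval_one, Polynomial.eval_natCast]
  positivity

lemma binomialBelow_one {n b : ℕ} (h : b ≤ n) : binomialBelow n b 1 = 0 := by
  refine Finset.sum_eq_zero fun k hk => ?_
  have := Finset.mem_range.1 hk
  rw [bernsteinPolynomial.eval_at_1, if_neg (by omega)]

/-- The derivatives of consecutive Bernstein polynomials telescope. For `n = 0` the truncated `n -
1` is harmless because the factor `n` vanishes. -/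
lemma derivative_sum_bernsteinPolynomial (n b : ℕ) :
    Polynomial.derivative (∑ k ∈ Finset.range (b + 1), bernsteinPolynomial ℝ n k) =
      -n * bernsteinPolynomial ℝ (n - 1) b := by
  induction b with
  | zero => simp [bernsteinPolynomial.derivative_zero]
  | succ b ih =>
    rw [Finset.sum_range_succ, Polynomial.derivative_add, ih, bernsteinPolynomial.derivative_succ]
    ring

lemma hasDerivAt_binomialBelow (n b : ℕ) (u : ℝ) :
    HasDerivAt (binomialBelow n (b + 1)) (-n * (bernsteinPolynomial ℝ (n - 1) b).eval u) u := by
  have h := (∑ k ∈ Finset.range (b + 1), bernsteinPolynomial ℝ n k).hasDerivAt u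
  rw [derivative_sum_bernsteinPolynomial] at h
  have hfun : (fun x => Polynomial.eval x (∑ k ∈ Finset.range (b + 1), bernsteinPolynomial ℝ n k)) =
      binomialBelow n (b + 1) := by
    funext x
    simp [binomialBelow, Polynomial.eval_finsetSum]
  rw [hfun] at h
  exact h.congr_deriv (by simp)

lemma ae_betaMeasure_mem_Ioo (a b : ℝ) : ∀ᵐ l ∂(betaMeasure a b), l ∈ Ioo (0 : ℝ) 1 := by
  rw [betaMeasure, ae_withDensity_iff (by
    unfold betaPDF; exact (measurable_betaPDFReal a b).ennreal_ofReal)]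
  refine ae_of_all _ fun l hl => ?_
  by_contra h
  rw [mem_Ioo, not_and_or, not_lt, not_lt] at h
  rcases h with h | h
  · exact hl (betaPDF_eq_zero_of_nonpos h)
  · exact hl (betaPDF_eq_zero_of_one_le h)

/-- Here `b = β - 1` and `m = α - β - 1`. The right side is arranged as `α/β` times the constant in
the derivative of the binomial tail. -/
lemma beta_natCast (b m : ℕ) :
    1 / beta ((b : ℝ) + 2) ((m : ℝ) + 1) =
      ((b + m + 2 : ℕ) : ℝ) / ((b + 1 : ℕ) : ℝ) * ((b + m + 1 : ℕ) : ℝ) * (b + m).choose b := by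
  have h1 : Real.Gamma ((b : ℝ) + 2) = (b + 1).factorial := by
    rw [← Real.Gamma_nat_eq_factorial]; congr 1; push_cast; ring
  have h2 : Real.Gamma ((m : ℝ) + 1) = m.factorial := Real.Gamma_nat_eq_factorial m
  have h3 : Real.Gamma ((b : ℝ) + 2 + ((m : ℝ) + 1)) = (b + m + 2).factorial := by
    rw [← Real.Gamma_nat_eq_factorial]; congr 1; push_cast; ring
  have h4 : ((b + m).choose b : ℝ) * b.factorial * m.factorial = (b + m).factorial := by
    have := Nat.choose_mul_factorial_mul_factorial (Nat.le_add_right b m)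
    rw [Nat.add_sub_cancel_left] at this
    exact_mod_cast this
  have h5 : ((b + m).choose b : ℝ) = (b + m).factorial / (b.factorial * m.factorial) := by
    rw [← h4]
    field_simp
  rw [beta, h1, h2, h3, h5, Nat.factorial_succ b, Nat.factorial_succ (b + m + 1),
    Nat.factorial_succ (b + m)]
  push_cast
  field_simp
  ring

/-- On `(0, 1)`, `l⁻¹` times the beta density is minus the derivative of the scaled binomial tail,
which vanishes at `1`. -/
lemma setLIntegral_inv_betaMeasure (b m : ℕ) {u : ℝ} (hu : u ∈ Icc (0 : ℝ) 1) :
    ∫⁻ l in Ici u, ENNReal.ofReal l⁻¹ ∂(betaMeasure ((b : ℝ) + 2) ((m : ℝ) + 1)) =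
      ENNReal.ofReal (((b + m + 2 : ℕ) : ℝ) / ((b + 1 : ℕ) : ℝ) *
        binomialBelow (b + m + 1) (b + 1) u) := by
  set c : ℝ := ((b + m + 2 : ℕ) : ℝ) / ((b + 1 : ℕ) : ℝ) with hc
  have hc0 : 0 ≤ c := by positivity
  set d : ℝ → ℝ := fun l => c * (((b + m + 1 : ℕ) : ℝ) * (bernsteinPolynomial ℝ (b + m) b).eval l)
    with hd
  have hdc : Continuous d := by rw [hd]; fun_prop
  have hd0 : ∀ l ∈ Icc (0 : ℝ) 1, 0 ≤ d l := by
    intro l hl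
    have h1 : 0 ≤ l := hl.1
    have h2 : 0 ≤ 1 - l := sub_nonneg.2 hl.2
    simp only [hd, bernsteinPolynomial, Polynomial.eval_mul, Polynomial.eval_pow,
      Polynomial.eval_X, Polynomial.eval_sub, Polynomial.eval_one, Polynomial.eval_natCast]
    positivity
  have hderiv : ∀ l, HasDerivAt (fun l => -(c * binomialBelow (b + m + 1) (b + 1) l)) (d l) l := by
    intro l
    refine ((hasDerivAt_binomialBelow (b + m + 1) b l).const_mul c).neg.congr_deriv ?_
    simp only [hd, Nat.add_sub_cancel]
    ring
  have hint : ∫ l in u..1, d l = c * binomialBelow (b + m + 1) (b + 1) u := by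
    rw [intervalIntegral.integral_eq_sub_of_hasDerivAt (fun l _ => hderiv l)
      (hdc.intervalIntegrable _ _), binomialBelow_one (by omega)]
    ring
  have hm : Measurable (betaPDF ((b : ℝ) + 2) ((m : ℝ) + 1)) := by
    unfold betaPDF
    exact (measurable_betaPDFReal _ _).ennreal_ofReal
  rw [betaMeasure, setLIntegral_withDensity_eq_setLIntegral_mul _ hm measurable_inv.ennreal_ofReal
    measurableSet_Ici, ← hint, intervalIntegral.integral_of_le hu.2,
    ofReal_integral_eq_lintegral_ofReal]
  · rw [← lintegral_indicator measurableSet_Ici, ← lintegral_indicator measurableSet_Ioc]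
    -- The two integrands can differ at the endpoints: `u` is excluded from `Ioc`, and at `1` the
    -- polynomial is nonzero when `m = 0` while `betaPDF` vanishes.
    have h1 : ∀ᵐ l : ℝ, l ≠ u := by simp [ae_iff]
    have h2 : ∀ᵐ l : ℝ, l ≠ 1 := by simp [ae_iff]
    refine lintegral_congr_ae ?_
    filter_upwards [h1, h2] with l hl1 hl2
    by_cases hlu : u ≤ l
    · rw [indicator_of_mem (by exact hlu), Pi.mul_apply]
      have hlu' : u < l := lt_of_le_of_ne hlu (Ne.symm hl1)
      have hl0 : 0 < l := hu.1.trans_lt hlu'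
      rcases lt_or_gt_of_ne hl2 with h | h
      · rw [indicator_of_mem (by exact ⟨hlu', h.le⟩), betaPDF_of_pos_lt_one hl0 h,
          ← ENNReal.ofReal_mul', beta_natCast]
        · congr 1
          have e1 : (b : ℝ) + 2 - 1 = ((b + 1 : ℕ) : ℝ) := by push_cast; ring
          have e2 : (m : ℝ) + 1 - 1 = (m : ℕ) := by ring
          rw [e1, e2, Real.rpow_natCast, Real.rpow_natCast]
          simp only [hd, bernsteinPolynomial, Polynomial.eval_mul, Polynomial.eval_pow,
            Polynomial.eval_X, Polynomial.eval_sub, Polynomial.eval_one, Polynomial.eval_natCast,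
            Nat.add_sub_cancel_left]
          rw [← hc, pow_succ]
          field_simp
        · exact (inv_pos.2 hl0).le
      · rw [betaPDF_eq_zero_of_one_le h.le, zero_mul,
          indicator_of_notMem (fun h' => not_le.2 h h'.2)]
    · rw [indicator_of_notMem (by exact hlu), indicator_of_notMem (fun h' => hlu h'.1.le)]
  · exact (hdc.integrableOn_Icc (a := u) (b := 1)).mono_set Ioc_subset_Icc_self
  · filter_upwards [ae_restrict_mem measurableSet_Ioc] with l hl
    exact hd0 l ⟨hu.1.trans hl.1.le, hl.2⟩

variable {Ω : Type*} [MeasurableSpace Ω] {P : Measure Ω} [IsProbabilityMeasure P]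

lemma utilityContribution_betaUtility {X W : Ω → ℝ} (hX : Integrable X P) (hW : Integrable W P)
    (hcont : ∀ c : ℝ, P {ω | W ω = c} = 0) {α β : ℕ} (hβ : 0 < β) (hβα : β < α) :
    utilityContribution P (betaUtility P α β) X W =
      (((α : ℝ) / β * ∫ ω, X ω * binomialBelow (α - 1) β (cdf (P.map W) (W ω)) ∂P : ℝ) :
        EReal) := by
  obtain ⟨b, rfl⟩ := Nat.exists_eq_succ_of_ne_zero hβ.ne'
  obtain ⟨m, rfl⟩ := Nat.exists_eq_add_of_lt hβα
  have e1 : ((b.succ : ℕ) : ℝ) + 1 = (b : ℝ) + 2 := by push_cast; ring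
  have e2 : ((b.succ + m + 1 : ℕ) : ℝ) - (b.succ : ℕ) = (m : ℝ) + 1 := by push_cast; ring
  have e3 : b.succ + m + 1 = b + m + 2 := by omega
  have hp : IsProbabilityMeasure (betaMeasure ((b : ℝ) + 2) ((m : ℝ) + 1)) :=
    isProbabilityMeasureBeta (by positivity) (by positivity)
  have h := utilityContribution_weightedUtility hX hW hcont
    (ae_betaMeasure_mem_Ioo ((b : ℝ) + 2) ((m : ℝ) + 1))
    (g := fun u => ((b + m + 2 : ℕ) : ℝ) / ((b + 1 : ℕ) : ℝ) *
        binomialBelow (b + m + 1) (b + 1) u)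
    (continuous_const.mul (continuous_binomialBelow _ _))
    (fun u hu => mul_nonneg (by positivity) (binomialBelow_nonneg _ _ hu))
    (fun u hu => setLIntegral_inv_betaMeasure b m hu)
  have e4 : betaUtility P ((b.succ + m + 1 : ℕ) : ℝ) (b.succ : ℕ) =
      weightedUtility P (betaMeasure ((b : ℝ) + 2) ((m : ℝ) + 1)) := by
    unfold betaUtility
    rw [e1, e2]
  rw [e4, h, ← integral_const_mul, e3, EReal.coe_eq_coe_iff]
  refine integral_congr_ae (ae_of_all _ fun ω => ?_)
  simp only [Nat.succ_eq_add_one, Nat.reduceSubDiff]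
  ring

end Beta

/-! ### Ranks of distinct real numbers. -/

section Rank

/-- The number of entries of `w` below `w j`. -/
noncomputable def rankBelow {m : ℕ} (w : Fin m → ℝ) (j : Fin m) : ℕ :=
  (Finset.univ.filter fun k => w k < w j).card

lemma rankBelow_sort {m : ℕ} {w : Fin m → ℝ} (hw : Function.Injective w) (i : Fin m) :
    rankBelow w (Tuple.sort w i) = i := by
  have hmono : StrictMono (w ∘ Tuple.sort w) :=
    (Tuple.monotone_sort w).strictMono_of_injective (hw.comp (Tuple.sort w).injective)
  have : (Finset.univ.filter fun k => w k < w (Tuple.sort w i)) =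
      (Finset.Iio i).map (Tuple.sort w).toEmbedding := by
    ext k
    obtain ⟨k', rfl⟩ := (Tuple.sort w).surjective k
    have := hmono.lt_iff_lt (a := k') (b := i)
    simpa using this
  rw [rankBelow, this, Finset.card_map, Fin.card_Iio]

lemma rankBelow_injective {m : ℕ} {w : Fin m → ℝ} (hw : Function.Injective w) :
    Function.Injective (rankBelow w) := by
  intro j j' h
  obtain ⟨i, rfl⟩ := (Tuple.sort w).surjective j
  obtain ⟨i', rfl⟩ := (Tuple.sort w).surjective j'
  rw [rankBelow_sort hw, rankBelow_sort hw] at h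
  rw [Fin.ext h]

lemma rankBelow_eq_of_eq_orderStat {m : ℕ} {w : Fin m → ℝ} (hw : Function.Injective w)
    {i n : Fin m} (h : w n = orderStat w i) : rankBelow w n = i := by
  rw [hw h, rankBelow_sort hw]

lemma rankBelow_eq_zero_of_le {m : ℕ} {w : Fin m → ℝ} {a : Fin m} (h : ∀ j, w a ≤ w j) :
    rankBelow w a = 0 := by
  rw [rankBelow, Finset.card_eq_zero, Finset.filter_eq_empty_iff]
  exact fun k _ => not_lt.2 (h k)

/-- Replaces a random index by a finite sum over deterministic ones, so that measurability and
integrability do not depend on how the index is selected. -/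
lemma sum_ite_rankBelow_eq {m : ℕ} {w : Fin m → ℝ} (hw : Function.Injective w) {n : Fin m} {i : ℕ}
    (h : rankBelow w n = i) (x : Fin m → ℝ) :
    ∑ j, (if rankBelow w j = i then x j else 0) = x n := by
  rw [Finset.sum_eq_single n]
  · rw [if_pos h]
  · intro j _ hj
    rw [if_neg fun h' => hj (rankBelow_injective hw (h'.trans h.symm))]
  · simp

lemma rankBelow_succAbove {m : ℕ} (w : Fin (m + 1) → ℝ) (j : Fin (m + 1)) :
    rankBelow w j = (Finset.univ.filter fun k => w (j.succAbove k) < w j).card := by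
  simp only [rankBelow, Finset.card_filter]
  rw [Fin.sum_univ_succAbove _ j]
  simp

lemma measurable_card_filter_lt {T : Type*} [MeasurableSpace T] {m : ℕ} {f : Fin m → T → ℝ}
    {h : T → ℝ} (hf : ∀ k, Measurable (f k)) (hh : Measurable h) :
    Measurable fun t => (Finset.univ.filter fun k => f k t < h t).card := by
  simp only [Finset.card_filter]
  exact Finset.measurable_sum _ fun k _ =>
    Measurable.ite (measurableSet_lt (hf k) hh) measurable_const measurable_const

end Rank

/-! ### Binomial counts under a product measure. -/

section Product

variable {E : Type*} [MeasurableSpace E] {ν : Measure E} [IsProbabilityMeasure ν]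

/-- The event splits according to the set `S` of coordinates that fall in `A`; each piece is a box
whose measure depends only on the size of `S`. -/
lemma measureReal_pi_card_mem_lt {m b : ℕ} (hb : b ≤ m) {A : Set E} [DecidablePred (· ∈ A)]
    (hA : MeasurableSet A) :
    (Measure.pi fun _ : Fin m => ν).real {v | (Finset.univ.filter fun k => v k ∈ A).card < b} =
      binomialBelow m b (ν.real A) := by
  classical
  set s : Finset (Finset (Fin m)) := (Finset.univ : Finset (Fin m)).powerset.filter
    fun S => S.card < b with hs
  set C : Finset (Fin m) → Set (Fin m → E) := fun S => univ.pi fun k => if k ∈ S then A else Aᶜ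
    with hC
  have hmem : ∀ S v, v ∈ C S ↔ (Finset.univ.filter fun k => v k ∈ A) = S := by
    intro S v
    simp only [hC, mem_univ_pi, Finset.ext_iff, Finset.mem_filter, Finset.mem_univ, true_and]
    refine forall_congr' fun k => ?_
    by_cases hk : k ∈ S <;> simp [hk]
  have hset : {v : Fin m → E | (Finset.univ.filter fun k => v k ∈ A).card < b} =
      ⋃ S ∈ s, C S := by
    ext v
    simp only [mem_iUnion, hmem, hs, Finset.mem_filter, Finset.mem_powerset]
    simp
  have hdisj : (s : Set (Finset (Fin m))).PairwiseDisjoint C := by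
    intro S _ T _ hST
    refine Set.disjoint_left.2 fun v h1 h2 => hST ?_
    rw [← (hmem S v).1 h1, ← (hmem T v).1 h2]
  have hval : ∀ S : Finset (Fin m), (Measure.pi fun _ : Fin m => ν).real (C S) =
      ν.real A ^ S.card * (1 - ν.real A) ^ (m - S.card) := by
    intro S
    rw [measureReal_def, hC, Measure.pi_pi, ENNReal.toReal_prod]
    have : ∀ k, (ν (if k ∈ S then A else Aᶜ)).toReal =
        if k ∈ S then ν.real A else 1 - ν.real A := by
      intro k
      split_ifs
      · rfl
      · rw [← measureReal_def, probReal_compl_eq_one_sub hA]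
    simp only [this]
    rw [Finset.prod_ite, Finset.prod_const, Finset.prod_const, Finset.filter_mem_eq_inter,
      Finset.univ_inter, Finset.filter_notMem_eq_sdiff, ← Finset.compl_eq_univ_sdiff,
      Finset.card_compl, Fintype.card_fin]
  rw [hset, measureReal_biUnion_finset hdisj fun S _ => MeasurableSet.univ_pi fun k => by
    split_ifs
    exacts [hA, hA.compl]]
  simp only [hval]
  rw [hs, Finset.sum_filter, Finset.sum_powerset_apply_card
    (fun k => if k < b then ν.real A ^ k * (1 - ν.real A) ^ (m - k) else 0), binomialBelow,
    Finset.card_univ, Fintype.card_fin]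
  refine (Finset.sum_subset_zero_on_sdiff (Finset.range_mono (by omega)) ?_ ?_).symm
  · intro k hk
    simp only [Finset.mem_sdiff, Finset.mem_range] at hk
    rw [if_neg hk.2, smul_zero]
  · intro k hk
    rw [if_pos (Finset.mem_range.1 hk)]
    simp [bernsteinPolynomial, mul_assoc]

end Product

/-! ### Mean of a coordinate on the event that its rank is small. -/

section OrderStatistics

variable {ν : Measure (ℝ × ℝ)} [IsProbabilityMeasure ν]

lemma measurable_ite_rankBelow {m : ℕ} (j : Fin m) (p : ℕ → Prop) [DecidablePred p] :
    Measurable fun v : Fin m → ℝ × ℝ =>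
      if p (rankBelow (fun k => (v k).2) j) then (v j).1 else 0 := by
  have hr : Measurable fun v : Fin m → ℝ × ℝ => rankBelow (fun k => (v k).2) j :=
    measurable_card_filter_lt (fun k => (measurable_pi_apply k).snd) (measurable_pi_apply j).snd
  exact Measurable.ite (hr (MeasurableSet.of_discrete (s := {n | p n})))
    (measurable_pi_apply j).fst measurable_const

/-- Fubini with coordinate `j` split off: once it is fixed at `z`, its rank counts how many of the
`m` others have second component below `z.2`, a binomial count. -/
lemma integral_pi_ite_rankBelow {m b : ℕ} (hb : b ≤ m) (hν : Integrable Prod.fst ν)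
    (j : Fin (m + 1)) :
    ∫ v, (if rankBelow (fun k => (v k).2) j < b then (v j).1 else 0)
      ∂(Measure.pi fun _ : Fin (m + 1) => ν) =
      ∫ z, z.1 * binomialBelow m b (ν.real {y | y.2 < z.2}) ∂ν := by
  set f : (ℝ × ℝ) × (Fin m → ℝ × ℝ) → ℝ := fun q =>
    if (Finset.univ.filter fun k => (q.2 k).2 < q.1.2).card < b then q.1.1 else 0 with hf
  have hcard : Measurable fun q : (ℝ × ℝ) × (Fin m → ℝ × ℝ) =>
      (Finset.univ.filter fun k => (q.2 k).2 < q.1.2).card :=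
    measurable_card_filter_lt (fun k => ((measurable_pi_apply k).comp measurable_snd).snd)
      measurable_fst.snd
  have hfm : Measurable f := Measurable.ite
    (hcard (MeasurableSet.of_discrete (s := {n | n < b}))) measurable_fst.fst measurable_const
  have hfi : Integrable f (ν.prod (Measure.pi fun _ : Fin m => ν)) := by
    refine (hν.comp_fst (Measure.pi fun _ : Fin m => ν)).mono hfm.aestronglyMeasurable
      (ae_of_all _ fun q => ?_)
    simp only [hf]
    split_ifs <;> simp
  have hmp := measurePreserving_piFinSuccAbove (fun _ : Fin (m + 1) => ν) j
  have hcomp := hmp.integral_comp (MeasurableEquiv.measurableEmbedding _) f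
  have hpt : ∀ v : Fin (m + 1) → ℝ × ℝ,
      f (MeasurableEquiv.piFinSuccAbove (fun _ => ℝ × ℝ) j v) =
        if rankBelow (fun k => (v k).2) j < b then (v j).1 else 0 := by
    intro v
    rw [rankBelow_succAbove]
    rfl
  simp only [hpt] at hcomp
  rw [hcomp, integral_prod _ hfi]
  refine integral_congr_ae (ae_of_all _ fun z => ?_)
  have hA : MeasurableSet {y : ℝ × ℝ | y.2 < z.2} := measurableSet_lt measurable_snd measurable_const
  have hB : MeasurableSet {v : Fin m → ℝ × ℝ |
      (Finset.univ.filter fun k => (v k).2 < z.2).card < b} :=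
    (measurable_card_filter_lt (fun k => (measurable_pi_apply k).snd) measurable_const)
      (MeasurableSet.of_discrete (s := {n | n < b}))
  classical
  have h := measureReal_pi_card_mem_lt (ν := ν) hb hA
  simp only [mem_ofPred_eq] at h
  have h' : ∀ v : Fin m → ℝ × ℝ, f (z, v) = {v : Fin m → ℝ × ℝ |
      (Finset.univ.filter fun k => (v k).2 < z.2).card < b}.indicator (fun _ => z.1) v := by
    intro v
    simp only [hf, indicator, mem_ofPred_eq]
  simp only [h', integral_indicator hB, setIntegral_const, smul_eq_mul]
  rw [mul_comm]
  congr 1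

end OrderStatistics

/-! ### Independent copies of `(X, W)`. -/

section Copies

variable {Ω : Type*} [MeasurableSpace Ω] {P : Measure Ω} {X W : Ω → ℝ}
  {Ω' : Type*} [MeasurableSpace Ω'] {P' : Measure Ω'}

lemma aemeasurable_copies {m : ℕ} {X' W' : Fin m → Ω' → ℝ}
    (hcopy : ∀ i, IdentDistrib (fun ω' => (X' i ω', W' i ω')) (fun ω => (X ω, W ω)) P' P) :
    AEMeasurable (fun ω' i => (X' i ω', W' i ω')) P' :=
  aemeasurable_pi_lambda _ fun i => (hcopy i).aemeasurable_fst

/-- Two independent copies of `W` have a product law; its diagonal is null because every slice is a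
single point. -/
lemma ae_injective_of_iIndepFun [IsProbabilityMeasure P'] {m : ℕ} {X' W' : Fin m → Ω' → ℝ}
    (hcont : ∀ c : ℝ, P {ω | W ω = c} = 0)
    (hcopy : ∀ i, IdentDistrib (fun ω' => (X' i ω', W' i ω')) (fun ω => (X ω, W ω)) P' P)
    (hindep : iIndepFun (fun i ω' => (X' i ω', W' i ω')) P') :
    ∀ᵐ ω' ∂P', Function.Injective fun k => W' k ω' := by
  have hW' : ∀ i, IdentDistrib (W' i) W P' P := fun i => (hcopy i).comp measurable_snd
  have hpair : ∀ i j, i ≠ j → ∀ᵐ ω' ∂P', W' i ω' ≠ W' j ω' := by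
    intro i j hij
    have hI : IndepFun (W' i) (W' j) P' :=
      (hindep.indepFun hij).comp measurable_snd measurable_snd
    have hi := (hW' i).aemeasurable_fst
    have hj := (hW' j).aemeasurable_fst
    have hlaw := (indepFun_iff_map_prod_eq_prod_map_map hi hj).1 hI
    have hs : MeasurableSet {p : ℝ × ℝ | p.1 = p.2} :=
      measurableSet_eq_fun measurable_fst measurable_snd
    have hzero : P'.map (fun ω' => (W' i ω', W' j ω')) {p : ℝ × ℝ | p.1 = p.2} = 0 := by
      have := Measure.isProbabilityMeasure_map (μ := P') hj
      rw [hlaw, Measure.measure_prod_null hs]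
      refine ae_of_all _ fun x => ?_
      have hx : Prod.mk x ⁻¹' {p : ℝ × ℝ | p.1 = p.2} = {x} := by
        ext y
        simp [eq_comm]
      beta_reduce
      rw [hx, Measure.map_apply_of_aemeasurable hj (measurableSet_singleton x), Pi.zero_apply,
        (hW' j).measure_mem_eq (measurableSet_singleton x)]
      exact hcont x
    rw [Measure.map_apply_of_aemeasurable (hi.prodMk hj) hs] at hzero
    rw [ae_iff]
    simpa using hzero
  have hall : ∀ᵐ ω' ∂P', ∀ i j, i ≠ j → W' i ω' ≠ W' j ω' := by
    refine ae_all_iff.2 fun i => ae_all_iff.2 fun j => ?_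
    by_cases hij : i = j
    · exact ae_of_all _ fun _ h => absurd hij h
    · exact (hpair i j hij).mono fun _ h _ => h
  filter_upwards [hall] with ω' h i j hij
  by_contra hne
  exact h i j hne hij

lemma integrable_ite_rankBelow {m : ℕ} {X' W' : Fin m → Ω' → ℝ} (hX : Integrable X P)
    (hcopy : ∀ i, IdentDistrib (fun ω' => (X' i ω', W' i ω')) (fun ω => (X ω, W ω)) P' P)
    (j : Fin m) (p : ℕ → Prop) [DecidablePred p] :
    Integrable (fun ω' => if p (rankBelow (fun k => W' k ω') j) then X' j ω' else 0) P' := by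
  have hXj : Integrable (X' j) P' :=
    (((hcopy j).comp measurable_fst).integrable_iff).2 hX
  refine hXj.mono ((measurable_ite_rankBelow j p).comp_aemeasurable
    (aemeasurable_copies hcopy)).aestronglyMeasurable (ae_of_all _ fun ω' => ?_)
  split_ifs <;> simp

lemma integral_ite_rankBelow [IsProbabilityMeasure P] {m b : ℕ} (hb : b ≤ m)
    {X' W' : Fin (m + 1) → Ω' → ℝ}
    (hX : Integrable X P) (hcont : ∀ c : ℝ, P {ω | W ω = c} = 0)
    (hcopy : ∀ i, IdentDistrib (fun ω' => (X' i ω', W' i ω')) (fun ω => (X ω, W ω)) P' P)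
    (hindep : iIndepFun (fun i ω' => (X' i ω', W' i ω')) P') (j : Fin (m + 1)) :
    ∫ ω', (if rankBelow (fun k => W' k ω') j < b then X' j ω' else 0) ∂P' =
      ∫ ω, X ω * binomialBelow m b (cdf (P.map W) (W ω)) ∂P := by
  have hXW : AEMeasurable (fun ω => (X ω, W ω)) P := (hcopy j).aemeasurable_snd
  have hWm : AEMeasurable W P := hXW.snd
  set ν := P.map (fun ω => (X ω, W ω)) with hν
  have hνp : IsProbabilityMeasure ν := Measure.isProbabilityMeasure_map hXW
  have hWp : IsProbabilityMeasure (P.map W) := Measure.isProbabilityMeasure_map hWm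
  have hlaw : P'.map (fun ω' i => (X' i ω', W' i ω')) =
      Measure.pi fun _ : Fin (m + 1) => ν := by
    rw [hindep.map_fun_eq_pi_map fun i => (hcopy i).aemeasurable_fst]
    congr 1
    funext i
    exact (hcopy i).map_eq
  have hνi : Integrable Prod.fst ν := by
    rw [hν, integrable_map_measure measurable_fst.aestronglyMeasurable hXW]
    exact hX
  have hmeas := measurable_ite_rankBelow j (fun n => n < b)
  have hcdf : ∀ c, ν.real {y : ℝ × ℝ | y.2 < c} = cdf (P.map W) c := by
    intro c
    have h1 : ν.real {y : ℝ × ℝ | y.2 < c} = (P.map W).real (Iio c) := by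
      rw [measureReal_def, measureReal_def, hν, Measure.map_apply_of_aemeasurable hXW
        (measurableSet_lt measurable_snd measurable_const),
        Measure.map_apply_of_aemeasurable hWm measurableSet_Iio]
      rfl
    rw [h1, cdf_eq_real]
    -- Ranks count strictly smaller entries while the distribution function includes equality;
    -- without atoms the two agree.
    refine measureReal_congr (Iio_ae_eq_Iic' ?_)
    rw [Measure.map_apply_of_aemeasurable hWm (measurableSet_singleton c)]
    exact hcont c
  have h := integral_pi_ite_rankBelow hb hνi j
  rw [← hlaw, integral_map (aemeasurable_copies hcopy) hmeas.aestronglyMeasurable] at h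
  simp only [hcdf] at h
  rw [h, hν, integral_map hXW]
  refine (measurable_fst.mul ?_).aestronglyMeasurable
  exact (continuous_binomialBelow m b).measurable.comp
    ((monotone_cdf (P.map W)).measurable.comp measurable_snd)

/-- The selected `X` is the double sum over `j`, `i` of `1{ξ = i} 1{rank of j is i} X_j`.
Independence turns the first factor into `1/b`, summing over `i` leaves the event that the rank is
below `b`, and all `m + 1` copies contribute equally. -/
lemma integrable_and_integral_orderStat [IsProbabilityMeasure P] [IsProbabilityMeasure P']
    {m b : ℕ} (hb : b ≤ m)
    {X' W' : Fin (m + 1) → Ω' → ℝ}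
    (hX : Integrable X P) (hcont : ∀ c : ℝ, P {ω | W ω = c} = 0)
    (hcopy : ∀ i, IdentDistrib (fun ω' => (X' i ω', W' i ω')) (fun ω => (X ω, W ω)) P' P)
    (hindep : iIndepFun (fun i ω' => (X' i ω', W' i ω')) P') {ξ : Ω' → Fin b}
    (hξ : HasLaw ξ (uniformOn Set.univ) P')
    (hξi : IndepFun ξ (fun ω' i => (X' i ω', W' i ω')) P') {N : Ω' → Fin (m + 1)}
    (hN : ∀ᵐ ω' ∂P', rankBelow (fun k => W' k ω') (N ω') = ξ ω') :
    Integrable (fun ω' => X' (N ω') ω') P' ∧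
      ∫ ω', X' (N ω') ω' ∂P' = ((m + 1 : ℕ) : ℝ) / b *
        ∫ ω, X ω * binomialBelow m b (cdf (P.map W) (W ω)) ∂P := by
  set V : Ω' → Fin (m + 1) → ℝ × ℝ := fun ω' i => (X' i ω', W' i ω') with hV
  set G : Fin (m + 1) → Fin b → (Fin (m + 1) → ℝ × ℝ) → ℝ := fun j i v =>
    if rankBelow (fun k => (v k).2) j = i then (v j).1 else 0 with hG
  set I : Fin b → Fin b → ℝ := fun i x => if x = i then 1 else 0 with hI
  have hGm : ∀ j i, Measurable (G j i) := fun j i => measurable_ite_rankBelow j (fun n => n = i)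
  have hIm : ∀ i, Measurable (I i) := fun i => measurable_of_finite _
  have hGi : ∀ j i, Integrable (fun ω' => G j i (V ω')) P' := fun j i =>
    integrable_ite_rankBelow hX hcopy j (fun n => n = i)
  have hIi : ∀ i, Integrable (fun ω' => I i (ξ ω')) P' := fun i =>
    Integrable.of_bound ((hIm i).comp_aemeasurable hξ.aemeasurable).aestronglyMeasurable 1
      (ae_of_all _ fun ω' => by simp only [hI]; split_ifs <;> simp)
  have hind : ∀ j i, IndepFun (fun ω' => I i (ξ ω')) (fun ω' => G j i (V ω')) P' := fun j i =>
    hξi.comp (hIm i) (hGm j i)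
  have hmul : ∀ j i, Integrable (fun ω' => I i (ξ ω') * G j i (V ω')) P' := fun j i =>
    (hind j i).integrable_mul (hIi i) (hGi j i)
  have hIint : ∀ i, ∫ ω', I i (ξ ω') ∂P' = (b : ℝ)⁻¹ := by
    intro i
    have h1 : ∫ ω', I i (ξ ω') ∂P' = ∫ x, I i x ∂(uniformOn (Set.univ : Set (Fin b))) := by
      rw [← hξ.map_eq, integral_map hξ.aemeasurable (hIm i).aestronglyMeasurable]
    have h2 : I i = ({i} : Set (Fin b)).indicator 1 := by
      funext x
      simp [hI, indicator]
    rw [h1, h2, integral_indicator_one (measurableSet_singleton i), measureReal_def,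
      uniformOn_univ, Measure.count_singleton, Fintype.card_fin]
    simp
  have hexp : (fun ω' => X' (N ω') ω') =ᵐ[P'] fun ω' => ∑ j, ∑ i, I i (ξ ω') * G j i (V ω') := by
    filter_upwards [hN, ae_injective_of_iIndepFun hcont hcopy hindep] with ω' h1 h2
    rw [← sum_ite_rankBelow_eq h2 h1 (fun j => X' j ω')]
    refine Finset.sum_congr rfl fun j _ => ?_
    rw [Finset.sum_eq_single (ξ ω')]
    · simp [hI, hG, hV]
    · intro i _ hi
      simp [hI, hi.symm]
    · simp
  have hint : Integrable (fun ω' => ∑ j, ∑ i, I i (ξ ω') * G j i (V ω')) P' :=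
    integrable_finsetSum _ fun j _ => integrable_finsetSum _ fun i _ => hmul j i
  refine ⟨hint.congr hexp.symm, ?_⟩
  have hsum : ∀ j ω', ∑ i, G j i (V ω') =
      if rankBelow (fun k => W' k ω') j < b then X' j ω' else 0 := by
    intro j ω'
    simp only [hG, hV]
    split_ifs with h
    · rw [Finset.sum_eq_single ⟨_, h⟩]
      · simp
      · intro i _ hi
        rw [if_neg fun h' => hi (Fin.ext h'.symm)]
      · simp
    · exact Finset.sum_eq_zero fun i _ => if_neg fun h' => h (h'.trans_lt i.2)
  have hj : ∀ j, ∫ ω', ∑ i, I i (ξ ω') * G j i (V ω') ∂P' =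
      (b : ℝ)⁻¹ * ∫ ω, X ω * binomialBelow m b (cdf (P.map W) (W ω)) ∂P := by
    intro j
    rw [integral_finsetSum _ fun i _ => hmul j i, ← integral_ite_rankBelow hb hX hcont hcopy hindep j]
    simp only [← hsum]
    rw [integral_finsetSum _ fun i _ => hGi j i, Finset.mul_sum]
    refine Finset.sum_congr rfl fun i _ => ?_
    rw [(hind j i).integral_fun_mul_eq_mul_integral (hIi i).aestronglyMeasurable
      (hGi j i).aestronglyMeasurable, hIint]
  rw [integral_congr_ae hexp, integral_finsetSum _ fun j _ =>
    integrable_finsetSum _ fun i _ => hmul j i]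
  simp only [hj, Finset.sum_const, Finset.card_univ, Fintype.card_fin, nsmul_eq_mul]
  ring

lemma integrable_and_integral_argmin [IsProbabilityMeasure P] [IsProbabilityMeasure P']
    {m : ℕ} (hm : 1 ≤ m)
    {X' W' : Fin (m + 1) → Ω' → ℝ}
    (hX : Integrable X P) (hcont : ∀ c : ℝ, P {ω | W ω = c} = 0)
    (hcopy : ∀ i, IdentDistrib (fun ω' => (X' i ω', W' i ω')) (fun ω => (X ω, W ω)) P' P)
    (hindep : iIndepFun (fun i ω' => (X' i ω', W' i ω')) P') {a : Ω' → Fin (m + 1)}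
    (ha : ∀ᵐ ω' ∂P', ∀ j, W' (a ω') ω' ≤ W' j ω') :
    Integrable (fun ω' => X' (a ω') ω') P' ∧
      ∫ ω', X' (a ω') ω' ∂P' = ((m + 1 : ℕ) : ℝ) *
        ∫ ω, X ω * binomialBelow m 1 (cdf (P.map W) (W ω)) ∂P := by
  have hexp : (fun ω' => X' (a ω') ω') =ᵐ[P'] fun ω' =>
      ∑ j, if rankBelow (fun k => W' k ω') j < 1 then X' j ω' else 0 := by
    filter_upwards [ha, ae_injective_of_iIndepFun hcont hcopy hindep] with ω' h1 h2
    simp only [Nat.lt_one_iff]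
    exact (sum_ite_rankBelow_eq h2 (rankBelow_eq_zero_of_le (w := fun k => W' k ω') h1)
      (fun j => X' j ω')).symm
  have hi := fun j => integrable_ite_rankBelow hX hcopy j (fun n => n < 1)
  refine ⟨(integrable_finsetSum _ fun j _ => hi j).congr hexp.symm, ?_⟩
  rw [integral_congr_ae hexp, integral_finsetSum _ fun j _ => hi j]
  simp only [integral_ite_rankBelow hm hX hcont hcopy hindep, Finset.sum_const, Finset.card_univ,
    Fintype.card_fin, nsmul_eq_mul]

end Copies

end RiskContribution

/-! ### The main theorem. -/

open RiskContribution in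
theorem mainTheorem11
    {Ω : Type*} [MeasurableSpace Ω] (P : Measure Ω) [IsProbabilityMeasure P]
    (X W : Ω → ℝ) (hX : Integrable X P) (hW : Integrable W P)
    (hcont : ∀ c : ℝ, P {ω | W ω = c} = 0)
    {Ω' : Type*} [MeasurableSpace Ω'] (P' : Measure Ω') [IsProbabilityMeasure P']
    (α : ℕ) (hα : 1 < α) (X' W' : Fin α → Ω' → ℝ)
    (hcopy : ∀ i, IdentDistrib (fun ω' => (X' i ω', W' i ω')) (fun ω => (X ω, W ω)) P' P)
    (hindep : iIndepFun (fun i ω' => (X' i ω', W' i ω')) P') :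
    -- almost surely, each order statistic is attained at exactly one index
    (∀ᵐ ω' ∂P', ∀ i, ∃! j, W' j ω' = orderStat (fun k => W' k ω') i) ∧
    -- the Beta V@R contribution; indices in `Fin` are zero-based
    (∀ (β : ℕ) (_ : 0 < β) (hβα : β < α) (ξ : Ω' → Fin β),
      HasLaw ξ (uniformOn Set.univ) P' →
      IndepFun ξ (fun ω' i => (X' i ω', W' i ω')) P' →
      ∀ n : Fin α → Ω' → Fin α,
        (∀ i, ∀ᵐ ω' ∂P', W' (n i ω') ω' = orderStat (fun k => W' k ω') i) →
        Integrable (fun ω' => X' (n (Fin.castLE hβα.le (ξ ω')) ω') ω') P' ∧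
        utilityContribution P (betaUtility P α β) X W =
          ((∫ ω', X' (n (Fin.castLE hβα.le (ξ ω')) ω') ω' ∂P' : ℝ) : EReal)) ∧
    -- the Alpha V@R contribution
    (∀ a : Ω' → Fin α,
      (∀ᵐ ω' ∂P', ∀ j, W' (a ω') ω' ≤ W' j ω') →
      Integrable (fun ω' => X' (a ω') ω') P' ∧
      utilityContribution P (alphaUtility P α) X W =
        ((∫ ω', X' (a ω') ω' ∂P' : ℝ) : EReal)) := by
  obtain ⟨m, rfl⟩ : ∃ m, α = m + 1 := ⟨α - 1, by omega⟩
  have hinj := ae_injective_of_iIndepFun hcont hcopy hindep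
  refine ⟨?_, ?_, ?_⟩
  · filter_upwards [hinj] with ω' h i
    exact ⟨Tuple.sort (fun k => W' k ω') i, rfl, fun j hj => h hj⟩
  · intro β hβ hβα ξ hξ hξi n hn
    have hN : ∀ᵐ ω' ∂P', rankBelow (fun k => W' k ω') (n (Fin.castLE hβα.le (ξ ω')) ω') = ξ ω' := by
      filter_upwards [hinj, ae_all_iff.2 hn] with ω' h1 h2
      exact rankBelow_eq_of_eq_orderStat h1 (h2 _)
    obtain ⟨h1, h2⟩ := integrable_and_integral_orderStat (Nat.lt_succ_iff.1 hβα) hX hcont hcopy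
      hindep hξ hξi hN
    refine ⟨h1, ?_⟩
    rw [utilityContribution_betaUtility hX hW hcont hβ hβα, h2, Nat.add_sub_cancel]
  · intro a ha
    obtain ⟨h1, h2⟩ := integrable_and_integral_argmin (by omega) hX hcont hcopy hindep ha
    refine ⟨h1, ?_⟩
    -- Alpha V@R is the case `β = 1`, where the only admissible rank is `0`, that of the argmin.
    have h := utilityContribution_betaUtility hX hW hcont one_pos hα
    rw [Nat.cast_one, div_one] at h
    rw [alphaUtility, h, h2, Nat.add_sub_cancel]
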